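/- Let $\mathcal L=\{\subseteq,\bot,\mathrm{At},\vartriangleleft\}$ be the first-order language with binary relation symbols $\subseteq,\vartriangleleft$, a constant $\bot$ and a unary relation symbol $\mathrm{At}$. Let $T_{\mathrm{MSO(Fin)}}$ be the $\mathcal L$-theory stating that: (i) $\subseteq$ is the order of an atomic Boolean algebra (possibly with $\bot=\top$) with bottom element $\bot$, and $\mathrm{At}$ holds exactly of its atoms; (ii) $\vartriangleleft$ restricts to a strict linear order on the atoms, and $X\vartriangleleft Y$ holds iff there are atoms $x\subseteq X$ and $y\subseteq Y$ with $x\vartriangleleft y$; (iii) comprehension: for every $\mathcal L$-formula $\eta(x;\bar Y)$, $\forall\bar Y\,\exists X\,\forall x\,(\mathrm{At}(x)\to(x\subseteq X\leftrightarrow\eta(x;\bar Y)))$; (iv) the linear order of the atoms is discrete (an atom that is not the largest has an immediate successor, and one that is not the smallest has an immediate predecessor) and, if there are any atoms, has a smallest and a largest element; (v) every $X\neq\bot$ contains a $\vartriangleleft$-smallest atom. Let $S_0$ be the set of complete (deductively closed, satisfiable) $\mathcal L$-theories extending $T_{\mathrm{MSO(Fin)}}$, with the topology that has as a basis the sets $\{T'\in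 S_0:\varphi\in T'\}$ for $\mathcal L$-sentences $\varphi$. For $\mathcal L$-structures $M,N$ that are models of $T_{\mathrm{MSO(Fin)}}$ let $M\otimes N$ be the $\mathcal L$-structure on $M\times N$ in which $\subseteq$ is defined componentwise, $\bot$ and $\mathrm{At}$ are the bottom element and the set of atoms of the resulting Boolean algebra, and $(A,B)\vartriangleleft(C,D)$ iff ($A\neq\bot$ and $D\neq\bot$) or $A\vartriangleleft C$ or $B\vartriangleleft D$. A ternary relation $R$ on a Boolean space (compact, Hausdorff, totally disconnected) $X$ is called compatible if $\{z:\exists x\in A\,\exists y\in B\ R(x,y,z)\}$ is clopen for all clopen $A,B\subseteq X$, and $\{(x,y):R(x,y,z)\}$ is closed in $X^2$ for every $z\in X$. A morphism $(X,R)\to(Y,S)$ is a continuous map $f$ such that $R(x,y,z)$ implies $S(f(x),f(y),f(z))$, and such that whenever $S(x',y',f(z))$ there are $x,y\in X$ with $f(x)=x'$, $f(y)=y'$ and $R(x,y,z)$. A binary operation is regarded as the ternary relation given by its graph. The free profinite monoid on one generator, $\widehat F_1$, is the inverse limit of all finite quotient monoids of the free monoid on one generator, with the topology induced by the product of the discrete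 topologies. **Theorem.** There is a binary operation $\otimes$ on $S_0$ such that $\mathrm{Th}(M\otimes N)=T\otimes T'$ for all $T,T'\in S_0$ and all models $M\models T$, $N\models T'$. The graph of $\otimes$ is a compatible ternary relation on the Boolean space $S_0$, the graph of the multiplication of $\widehat F_1$ is a compatible ternary relation on the Boolean space $\widehat F_1$, and $(S_0,\otimes)$ and $\widehat F_1$ are isomorphic in the category of Boolean spaces with a compatible ternary relation; that is, $(S_0,\otimes)$ is the free profinite monoid on one generator. -/

import Mathlib

open FirstOrder FirstOrder.Language

namespace MSOFin

/-! ### The first-order language and its theories -/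

/-- Function symbols: a single constant symbol for the bottom element. -/
inductive Func : ℕ → Type
  | bot : Func 0

/-- Relation symbols: inclusion, the unary atom predicate, and the extended strict order. -/
inductive Rel : ℕ → Type
  | sub : Rel 2
  | atm : Rel 1
  | lt : Rel 2

/-- The language `{⊆, ⊥, At, ◁}`. -/
def lang : FirstOrder.Language.{0, 0} := ⟨Func, Rel⟩

/-- The constant symbol `⊥`. -/
def botS : lang.Constants := Func.bot

/-- The relation symbol `⊆`. -/
def subS : lang.Relations 2 := Rel.sub

/-- The relation symbol `At`. -/
def atmS : lang.Relations 1 := Rel.atm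

/-- The relation symbol `◁`. -/
def ltS : lang.Relations 2 := Rel.lt

section Formulas

variable {n : ℕ}

/-- The `i`-th quantified variable (counted from the outside). -/
def v (i : Fin n) : lang.Term (Empty ⊕ Fin n) := Term.var (Sum.inr i)

/-- The constant `⊥`, as a term. -/
def botT : lang.Term (Empty ⊕ Fin n) := botS.term

/-- The formula `s ⊆ t`. -/
def subF (s t : lang.Term (Empty ⊕ Fin n)) : lang.BoundedFormula Empty n :=
  subS.boundedFormula₂ s t

/-- The formula `s ◁ t`. -/
def ltF (s t : lang.Term (Empty ⊕ Fin n)) : lang.BoundedFormula Empty n :=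
  ltS.boundedFormula₂ s t

/-- The formula `At(t)`. -/
def atF (t : lang.Term (Empty ⊕ Fin n)) : lang.BoundedFormula Empty n :=
  atmS.boundedFormula₁ t

/-- `∀ x, φ` with `x` ranging over atoms. -/
def allAt (φ : lang.BoundedFormula Empty (n + 1)) : lang.BoundedFormula Empty n :=
  ∀' (atF (v (Fin.last n)) ⟹ φ)

/-- `∃ x, φ` with `x` ranging over atoms. -/
def exAt (φ : lang.BoundedFormula Empty (n + 1)) : lang.BoundedFormula Empty n :=
  ∃' (atF (v (Fin.last n)) ⊓ φ)

/-- The `k`-th variable is a join (least upper bound) of the `i`-th and the `j`-th. -/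
def isJoin (i j k : Fin n) : lang.BoundedFormula Empty n :=
  subF (v i) (v k) ⊓ subF (v j) (v k) ⊓
    ∀' (subF (v i.castSucc) (v (Fin.last n)) ⊓ subF (v j.castSucc) (v (Fin.last n)) ⟹
      subF (v k.castSucc) (v (Fin.last n)))

/-- The `k`-th variable is a meet (greatest lower bound) of the `i`-th and the `j`-th. -/
def isMeet (i j k : Fin n) : lang.BoundedFormula Empty n :=
  subF (v k) (v i) ⊓ subF (v k) (v j) ⊓
    ∀' (subF (v (Fin.last n)) (v i.castSucc) ⊓ subF (v (Fin.last n)) (v j.castSucc) ⟹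
      subF (v (Fin.last n)) (v k.castSucc))

/-- The `k`-th variable is a least element. -/
def isLeast (k : Fin n) : lang.BoundedFormula Empty n :=
  ∀' (subF (v k.castSucc) (v (Fin.last n)))

/-- The `k`-th variable is a greatest element. -/
def isGreatest (k : Fin n) : lang.BoundedFormula Empty n :=
  ∀' (subF (v (Fin.last n)) (v k.castSucc))

/-- The `k`-th variable is minimal with respect to `⊆` among the elements different
from `⊥`. -/
def isMinNonBot (k : Fin n) : lang.BoundedFormula Empty n :=
  ∼(v k =' botT) ⊓
    ∀' (subF (v (Fin.last n)) (v k.castSucc) ⟹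
      (v (Fin.last n) =' botT) ⊔ (v (Fin.last n) =' v k.castSucc))

end Formulas

/-- Boolean algebra (a complemented distributive lattice, possibly with one element) under
`⊆`. -/
def booleanAxioms : lang.Theory :=
  { -- partial order
    ∀' subF (v 0) (v 0),
    ∀' ∀' ∀' (subF (v 0) (v 1) ⊓ subF (v 1) (v 2) ⟹ subF (v 0) (v 2)),
    ∀' ∀' (subF (v 0) (v 1) ⊓ subF (v 1) (v 0) ⟹ v 0 =' v 1),
    -- least and greatest elements, joins and meets
    ∃' isLeast 0,
    ∃' isGreatest 0,
    ∀' ∀' ∃' isJoin 0 1 2,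
    ∀' ∀' ∃' isMeet 0 1 2,
    -- distributivity: `x ⊓ (y ⊔ z) ⊆ (x ⊓ y) ⊔ (x ⊓ z)`, with the variables
    -- `x, y, z, y ⊔ z, x ⊓ (y ⊔ z), x ⊓ y, x ⊓ z, (x ⊓ y) ⊔ (x ⊓ z)` in this order
    ∀' ∀' ∀' ∀' ∀' ∀' ∀' ∀' (isJoin 1 2 3 ⊓ isMeet 0 3 4 ⊓ isMeet 0 1 5 ⊓ isMeet 0 2 6 ⊓
      isJoin 5 6 7 ⟹ subF (v 4) (v 7)),
    -- complements
    ∀' ∃' ((∀' (isMeet 0 1 2 ⟹ isLeast 2)) ⊓ (∀' (isJoin 0 1 2 ⟹ isGreatest 2))) }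

/-- The axioms that tie `⊥`, `At` and `◁` to the Boolean algebra, together with atomicity and
the linear order of the atoms. -/
def atomAxioms : lang.Theory :=
  { -- `⊥` is the bottom element
    ∀' subF botT (v 0),
    -- `At` holds precisely of the atoms
    ∀' (atF (v 0) ⇔ isMinNonBot 0),
    -- atomic: below every element other than `⊥` there is an atom
    ∀' (∼(v 0 =' botT) ⟹ exAt (subF (v 1) (v 0))),
    -- `◁` is a strict linear order on the atoms
    allAt (∼(ltF (v 0) (v 0))),
    allAt (allAt (allAt (ltF (v 0) (v 1) ⊓ ltF (v 1) (v 2) ⟹ ltF (v 0) (v 2)))),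
    allAt (allAt (ltF (v 0) (v 1) ⊔ (v 0 =' v 1) ⊔ ltF (v 1) (v 0))),
    -- `◁` is determined by its restriction to the atoms
    ∀' ∀' (ltF (v 0) (v 1) ⇔
      exAt (exAt (subF (v 2) (v 0) ⊓ subF (v 3) (v 1) ⊓ ltF (v 2) (v 3)))) }

/-- The comprehension axiom `∀ Ȳ ∃ X ∀ x (x ⊆ X ↔ η(x; Ȳ))`, `x` ranging over atoms, of a formula
`η` whose variable `0` is `x` and whose variables `1, …, n` are the parameters `Ȳ`. In the scope
of the quantifiers the variables are `Ȳ` (numbers `0, …, n - 1`), `X` (number `n`) and `x`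
(number `n + 1`). -/
def comp {n : ℕ} (η : lang.Formula (Fin (n + 1))) : lang.Sentence :=
  BoundedFormula.alls (n := n) (∃' (allAt
    (subF (v (Fin.last (n + 1))) (v (Fin.last n).castSucc) ⇔
      BoundedFormula.relabel (k := 0) (n := n + 2)
        (fun i : Fin (n + 1) => (Sum.inr (Fin.cons (α := fun _ => Fin (n + 2)) (Fin.last (n + 1))
          (fun j : Fin n => j.castSucc.castSucc) i) : Empty ⊕ Fin (n + 2))) η)))

/-- The base theory of monadic second order versions of linear orders. -/
def Tbase : lang.Theory :=
  booleanAxioms ∪ atomAxioms ∪ {φ | ∃ (n : ℕ) (η : lang.Formula (Fin (n + 1))), φ = comp η}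

/-- The additional axioms for finite linear orders. The empty order is allowed: endpoints are
required only if there is an atom at all. -/
def finAxioms : lang.Theory :=
  { -- endpoints
    ∀' (atF (v 0) ⟹ exAt (allAt (v 2 =' v 1 ⊔ ltF (v 1) (v 2)))),
    ∀' (atF (v 0) ⟹ exAt (allAt (v 2 =' v 1 ⊔ ltF (v 2) (v 1)))),
    -- discreteness: immediate successors and predecessors
    allAt (exAt (ltF (v 0) (v 1)) ⟹
      exAt (ltF (v 0) (v 1) ⊓ allAt (∼(ltF (v 0) (v 2) ⊓ ltF (v 2) (v 1))))),
    allAt (exAt (ltF (v 1) (v 0)) ⟹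
      exAt (ltF (v 1) (v 0) ⊓ allAt (∼(ltF (v 1) (v 2) ⊓ ltF (v 2) (v 0))))),
    -- every element other than `⊥` contains a smallest atom
    ∀' (∼(v 0 =' botT) ⟹
      exAt (subF (v 1) (v 0) ⊓ allAt (ltF (v 2) (v 1) ⟹ ∼(subF (v 2) (v 0))))) }

/-- The theory `T_MSO(Fin)`. -/
def TMSOFin : lang.Theory := Tbase ∪ finAxioms

/-! ### The space of completions -/

/-- The space `S₀(T)` of `0`-types: the (satisfiable, deductively closed) complete theories
extending `T`. -/
def ZeroTypes {L : FirstOrder.Language.{0, 0}} (T : L.Theory) : Type :=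
  {T' : L.Theory // T ⊆ T' ∧ T'.IsMaximal}

/-- The topology with basis the sets `⟨φ⟩` of completions that contain the sentence `φ`. -/
instance {L : FirstOrder.Language.{0, 0}} (T : L.Theory) : TopologicalSpace (ZeroTypes T) :=
  TopologicalSpace.generateFrom (Set.range fun φ : L.Sentence => {p : ZeroTypes T | φ ∈ p.1})

/-! ### Concatenation of structures -/

section Concat

universe u₁ u₂

/-- The interpretation of `⊥`. -/
def botE (M : Type u₁) [lang.Structure M] : M := (botS : M)

/-- The interpretation of `⊆`. -/
def SubE {M : Type u₁} [lang.Structure M] (a b : M) : Prop :=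
  Structure.RelMap subS ![a, b]

/-- The interpretation of `◁`. -/
def LtE {M : Type u₁} [lang.Structure M] (a b : M) : Prop :=
  Structure.RelMap ltS ![a, b]

/-- The underlying set of the concatenation of two structures. -/
def Concat (M : Type u₁) (N : Type u₂) : Type (max u₁ u₂) := M × N

variable {M : Type u₁} {N : Type u₂} [lang.Structure M] [lang.Structure N]

/-- Inclusion in the concatenation: that of the direct product. -/
def Concat.Sub (p q : M × N) : Prop := SubE p.1 q.1 ∧ SubE p.2 q.2

/-- The atoms of the concatenation: the minimal elements, with respect to inclusion, among the
non-bottom ones. -/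
def Concat.Atom (p : M × N) : Prop :=
  p ≠ (botE M, botE N) ∧ ∀ q : M × N, Concat.Sub q p → q = (botE M, botE N) ∨ q = p

/-- The extended order of the concatenation: everything in `M` is before everything in `N`. -/
def Concat.Lt (p q : M × N) : Prop :=
  (p.1 ≠ botE M ∧ q.2 ≠ botE N) ∨ LtE p.1 q.1 ∨ LtE p.2 q.2

/-- The concatenation of two structures: direct product of the Boolean algebras, ordered sum of
the linear orders of atoms. -/
instance : lang.Structure (Concat M N) where
  funMap {_} f _ := match f with
    | Func.bot => (botE M, botE N)
  RelMap {_} r := match r with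
    | Rel.sub => fun x => Concat.Sub (x 0) (x 1)
    | Rel.atm => fun x => Concat.Atom (x 0)
    | Rel.lt => fun x => Concat.Lt (x 0) (x 1)

end Concat

/-! ### Boolean spaces with a compatible ternary relation -/

section Ternary

universe u₁ u₂

/-- `X` is a Boolean space and `R` is a compatible ternary relation on it. -/
structure IsBooleanTernarySpace {X : Type u₁} [TopologicalSpace X] (R : X → X → X → Prop) :
    Prop where
  compact : CompactSpace X
  hausdorff : T2Space X
  totallyDisconnected : TotallyDisconnectedSpace X
  isClopen_mul : ∀ A B : Set X, IsClopen A → IsClopen B →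
    IsClopen {z | ∃ x ∈ A, ∃ y ∈ B, R x y z}
  isClosed_fibre : ∀ z : X, IsClosed {p : X × X | R p.1 p.2 z}

/-- The morphisms of Boolean spaces with a compatible ternary relation (bounded morphisms). -/
structure IsBoundedMorphism {X : Type u₁} {Y : Type u₂} [TopologicalSpace X] [TopologicalSpace Y]
    (R : X → X → X → Prop) (S : Y → Y → Y → Prop) (f : X → Y) : Prop where
  continuous : Continuous f
  map : ∀ x y z, R x y z → S (f x) (f y) (f z)
  lift : ∀ z x' y', S x' y' (f z) → ∃ x y, f x = x' ∧ f y = y' ∧ R x y z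

/-- Isomorphism in the category of Boolean spaces with a compatible ternary relation: there are
mutually inverse morphisms. -/
def Isomorphic {X : Type u₁} {Y : Type u₂} [TopologicalSpace X] [TopologicalSpace Y]
    (R : X → X → X → Prop) (S : Y → Y → Y → Prop) : Prop :=
  ∃ (f : X → Y) (g : Y → X), IsBoundedMorphism R S f ∧ IsBoundedMorphism S R g ∧
    Function.LeftInverse g f ∧ Function.RightInverse g f

/-- A binary operation viewed as a ternary relation. -/
def graph {X : Type u₁} (op : X → X → X) : X → X → X → Prop := fun x y z => op x y = z

end Ternary

/-! ### Free profinite monoids -/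

/-- The congruences of finite index of the free monoid on `A`. -/
def FinCon (A : Type) : Type := {c : Con (FreeMonoid A) // Finite c.Quotient}

/-- The free profinite monoid on `A`: the inverse limit of the finite quotients of the free monoid
on `A`, as a submonoid of their product. -/
def freeProfiniteMonoid (A : Type) : Submonoid (∀ c : FinCon A, c.1.Quotient) where
  carrier := {x | ∀ (c d : FinCon A) (h : c.1 ≤ d.1), Con.map c.1 d.1 h (x c) = x d}
  one_mem' := fun c d h => map_one (Con.map c.1 d.1 h)
  mul_mem' := fun {x y} hx hy c d h => by
    rw [Pi.mul_apply, Pi.mul_apply, map_mul, hx c d h, hy c d h]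

/-- The underlying type of the free profinite monoid on `A`. -/
def FreeProfiniteMonoid (A : Type) : Type := freeProfiniteMonoid A

instance (A : Type) : Monoid (FreeProfiniteMonoid A) :=
  inferInstanceAs (Monoid (freeProfiniteMonoid A))

/-- The profinite topology: the one induced by the product of the discrete topologies. -/
instance (A : Type) : TopologicalSpace (FreeProfiniteMonoid A) :=
  TopologicalSpace.induced (Subtype.val : freeProfiniteMonoid A → ∀ c : FinCon A, c.1.Quotient)
    (@Pi.topologicalSpace (FinCon A) (fun c => c.1.Quotient) (fun _ => ⊥))

end MSOFin

-- Modulo `TMSOFin` a sentence is determined by its spectrum, the set of sizes of the finite models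
-- `PowS n` in which it holds. The spectra are exactly the eventually periodic sets of natural
-- numbers, that is, the recognizable languages over one letter, and these are the traces on ℕ of
-- the clopen subsets of the free profinite monoid on one generator. Hence completions are profinite
-- natural numbers, and since sizes add under concatenation, `⊗` is their multiplication.
--
-- Three facts carry the argument. Composition (`realize_rects`): truth of a formula in `M ⊗ N` is a
-- finite union of rectangles, conditions on `M` times conditions on `N`, computed from the formula
-- alone. This makes `⊗` well defined on theories, preserves comprehension under `⊗`, and with the
-- pigeonhole principle makes spectra eventually periodic. Pseudofiniteness (`Good.exists_powS`): a
-- sentence true in a model of `TMSOFin` is true in some `PowS n`, by an induction along the atoms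
-- that comprehension and least atoms permit. Definability (`EvPeriodic.exists_spec_eq`): finite
-- sets and arithmetic progressions are spectra, hence so are all eventually periodic sets.
--
-- The map `limitTheory` sends a profinite number `x` to the set of sentences whose spectrum
-- contains all natural numbers agreeing with `x` modulo some finite index congruence. It is
-- continuous and multiplicative, injective by definability, surjective by definability and
-- pseudofiniteness; being a bijection from a compact to a Hausdorff space, it is a homeomorphism.
-- On the profinite side compatibility of multiplication reduces to the fact that sums of eventually
-- periodic sets are eventually periodic. Everything, including compactness of the space of
-- completions, is then transported along the homeomorphism.

namespace MSOFin

universe u₁ u₂ u₃ w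

/-! ### Semantics of the atomic formulas -/

section Atomic

variable {M : Type u₁} {N : Type u₂} [lang.Structure M] [lang.Structure N]

/-- The interpretation of `At`. -/
def AtE (a : M) : Prop := Structure.RelMap atmS ![a]

theorem functions_zero (f : lang.Functions 0) : f = botS := by cases f; rfl

@[elab_as_elim]
theorem functions_cases {motive : ∀ l, lang.Functions l → Prop} (bot : motive 0 botS) :
    ∀ (l : ℕ) (f : lang.Functions l), motive l f
  | _, Func.bot => bot

@[elab_as_elim]
theorem relations_cases {motive : ∀ l, lang.Relations l → Prop} (sub : motive 2 subS)
    (atm : motive 1 atmS) (lt : motive 2 ltS) : ∀ (l : ℕ) (R : lang.Relations l), motive l R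
  | _, Rel.sub => sub
  | _, Rel.atm => atm
  | _, Rel.lt => lt

theorem realize_term_botE {β : Type*} (f : lang.Functions 0) (ts : Fin 0 → lang.Term β)
    (v : β → M) : (Term.func f ts).realize v = botE M := by
  rw [functions_zero f, Term.realize_func]
  exact congrArg _ (Subsingleton.elim _ _)

@[simp] theorem realize_botT {n : ℕ} (v : Empty ⊕ Fin n → M) :
    (botT : lang.Term (Empty ⊕ Fin n)).realize v = botE M := realize_term_botE _ _ _

@[simp] theorem realize_v {n : ℕ} (i : Fin n) (e : Empty → M) (xs : Fin n → M) :
    (MSOFin.v i).realize (Sum.elim e xs) = xs i := rfl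

variable {n : ℕ} (s t : lang.Term (Empty ⊕ Fin n)) (e : Empty → M) (xs : Fin n → M)

@[simp] theorem realize_subF : (subF s t).Realize e xs ↔
    SubE (s.realize (Sum.elim e xs)) (t.realize (Sum.elim e xs)) :=
  BoundedFormula.realize_rel₂

@[simp] theorem realize_ltF : (ltF s t).Realize e xs ↔
    LtE (s.realize (Sum.elim e xs)) (t.realize (Sum.elim e xs)) :=
  BoundedFormula.realize_rel₂

@[simp] theorem realize_atF : (atF t).Realize e xs ↔ AtE (t.realize (Sum.elim e xs)) :=
  BoundedFormula.realize_rel₁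

@[simp] theorem realize_allAt (φ : lang.BoundedFormula Empty (n + 1)) :
    (allAt φ).Realize e xs ↔ ∀ a : M, AtE a → φ.Realize e (Fin.snoc xs a) := by
  simp [allAt]

@[simp] theorem realize_exAt (φ : lang.BoundedFormula Empty (n + 1)) :
    (exAt φ).Realize e xs ↔ ∃ a : M, AtE a ∧ φ.Realize e (Fin.snoc xs a) := by
  simp [exAt]

theorem relMap_sub (x : Fin 2 → M) : Structure.RelMap subS x ↔ SubE (x 0) (x 1) := by
  rw [SubE, iff_eq_eq]; congr 1; ext i; fin_cases i <;> rfl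

theorem relMap_lt (x : Fin 2 → M) : Structure.RelMap ltS x ↔ LtE (x 0) (x 1) := by
  rw [LtE, iff_eq_eq]; congr 1; ext i; fin_cases i <;> rfl

theorem relMap_atm (x : Fin 1 → M) : Structure.RelMap atmS x ↔ AtE (x 0) := by
  rw [AtE, iff_eq_eq]; congr 1; ext i; fin_cases i; rfl

theorem funMap_eq_botE (f : lang.Functions 0) (x : Fin 0 → M) :
    Structure.funMap f x = botE M := by
  rw [functions_zero f]
  exact congrArg _ (Subsingleton.elim _ _)

end Atomic

/-! ### Partial orders with bottom element in which `At` holds of the minimal elements -/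

/-- `⊆` is a reflexive and antisymmetric relation with least element `⊥`, and `At` holds of the
minimal elements other than `⊥`. -/
structure Pre (M : Type u₁) [lang.Structure M] : Prop where
  refl : ∀ a : M, SubE a a
  antisymm : ∀ a b : M, SubE a b → SubE b a → a = b
  bot_sub : ∀ a : M, SubE (botE M) a
  at_iff : ∀ a : M, AtE a ↔ a ≠ botE M ∧ ∀ b, SubE b a → b = botE M ∨ b = a

section Concat

variable {M : Type u₁} {N : Type u₂} [lang.Structure M] [lang.Structure N]

theorem Pre.sub_bot (h : Pre M) {a : M} : SubE a (botE M) ↔ a = botE M :=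
  ⟨fun h' => h.antisymm _ _ h' (h.bot_sub _), fun h' => h' ▸ h.refl _⟩

theorem Pre.eq_of_at (h : Pre M) {a b : M} (ha : AtE a) (hb : AtE b) (hab : SubE a b) : a = b :=
  (((h.at_iff b).1 hb).2 a hab).resolve_left ((h.at_iff a).1 ha).1

theorem Pre.ne_bot (h : Pre M) {a : M} (ha : AtE a) : a ≠ botE M := ((h.at_iff a).1 ha).1

/-- The first component of an element of a concatenation. -/
def Concat.fst (p : Concat M N) : M := Prod.fst p

/-- The second component of an element of a concatenation. -/
def Concat.snd (p : Concat M N) : N := Prod.snd p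

/-- The element of a concatenation with given components. -/
def Concat.mk (a : M) (b : N) : Concat M N := (a, b)

omit [lang.Structure M] [lang.Structure N] in
@[simp] theorem Concat.fst_mk (a : M) (b : N) : (Concat.mk a b).fst = a := rfl

omit [lang.Structure M] [lang.Structure N] in
@[simp] theorem Concat.snd_mk (a : M) (b : N) : (Concat.mk a b).snd = b := rfl

omit [lang.Structure M] [lang.Structure N] in
theorem Concat.ext_iff {p q : Concat M N} : p = q ↔ p.fst = q.fst ∧ p.snd = q.snd := Prod.ext_iff

omit [lang.Structure M] [lang.Structure N] in
theorem Concat.ext {p q : Concat M N} (h : p.fst = q.fst) (h' : p.snd = q.snd) : p = q :=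
  Prod.ext h h'

@[simp] theorem fst_botE : (botE (Concat M N)).fst = botE M := rfl

@[simp] theorem snd_botE : (botE (Concat M N)).snd = botE N := rfl

theorem subE_concat {p q : Concat M N} :
    SubE p q ↔ SubE p.fst q.fst ∧ SubE p.snd q.snd := Iff.rfl

theorem ltE_concat {p q : Concat M N} : LtE p q ↔
    (p.fst ≠ botE M ∧ q.snd ≠ botE N) ∨ LtE p.fst q.fst ∨ LtE p.snd q.snd := Iff.rfl

theorem Pre.concat (hM : Pre M) (hN : Pre N) : Pre (Concat M N) where
  refl _ := ⟨hM.refl _, hN.refl _⟩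
  antisymm _ _ h h' := Prod.ext (hM.antisymm _ _ h.1 h'.1) (hN.antisymm _ _ h.2 h'.2)
  bot_sub _ := ⟨hM.bot_sub _, hN.bot_sub _⟩
  at_iff _ := Iff.rfl

/-- Minimality in the product is a condition on both components jointly; this form, a union of two
rectangles, is what the decomposition of `At` uses. -/
theorem atE_concat (hM : Pre M) (hN : Pre N) {p : Concat M N} :
    AtE p ↔ (AtE p.fst ∧ p.snd = botE N) ∨ (p.fst = botE M ∧ AtE p.snd) := by
  rw [(hM.concat hN).at_iff]
  constructor
  · rintro ⟨h0, h⟩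
    by_cases ha : p.fst = botE M
    · right
      refine ⟨ha, (hN.at_iff _).2 ⟨fun hb => h0 (Concat.ext ha hb), fun y hy => ?_⟩⟩
      have := h (.mk (botE M) y) ⟨hM.bot_sub _, hy⟩
      exact this.imp (congrArg Concat.snd) (congrArg Concat.snd)
    · left
      have h1 := (h (.mk p.fst (botE N)) ⟨hM.refl _, hN.bot_sub _⟩).resolve_left
        fun h' => ha (congrArg Concat.fst h')
      have hb : botE N = p.snd := congrArg Concat.snd h1
      refine ⟨(hM.at_iff _).2 ⟨ha, fun x hx => ?_⟩, hb.symm⟩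
      have := h (.mk x (botE N)) ⟨hx, hN.bot_sub _⟩
      exact this.imp (congrArg Concat.fst) (congrArg Concat.fst)
  · rintro (⟨h1, h2⟩ | ⟨h1, h2⟩)
    · obtain ⟨h0, h3⟩ := (hM.at_iff _).1 h1
      refine ⟨fun h => h0 (congrArg Concat.fst h), fun q hq => ?_⟩
      have hq2 : q.snd = botE N := hN.sub_bot.1 (h2 ▸ (subE_concat.1 hq).2)
      exact (h3 _ (subE_concat.1 hq).1).imp (fun h => Concat.ext h hq2)
        (fun h => Concat.ext h (hq2.trans h2.symm))
    · obtain ⟨h0, h3⟩ := (hN.at_iff _).1 h2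
      refine ⟨fun h => h0 (congrArg Concat.snd h), fun q hq => ?_⟩
      have hq1 : q.fst = botE M := hM.sub_bot.1 (h1 ▸ (subE_concat.1 hq).1)
      exact (h3 _ (subE_concat.1 hq).2).imp (fun h => Concat.ext hq1 h)
        (fun h => Concat.ext (hq1.trans h1.symm) h)

end Concat

/-! ### Decomposition of formulas over concatenations -/

section Decomposition

variable {α : Type w} {n : ℕ}

/-- Finite unions of rectangles `φ × ψ`. -/
abbrev Rects (α : Type w) (n : ℕ) : Type w :=
  List (lang.BoundedFormula α n × lang.BoundedFormula α n)

/-- The complement of a finite union of rectangles. -/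
def Rects.neg : Rects α n → Rects α n
  | [] => [(⊤, ⊤)]
  -- A pair lies outside a rectangle iff one of its components violates the corresponding side.
  | p :: l => (neg l).map (fun q => (q.1 ⊓ ∼p.1, q.2)) ++ (neg l).map (fun q => (q.1, q.2 ⊓ ∼p.2))

/-- Decomposition of an atomic formula with a relation symbol. -/
def rectsRel : {l : ℕ} → lang.Relations l → (Fin l → lang.Term (α ⊕ Fin n)) → Rects α n
  | _, Rel.sub, ts => [(Relations.boundedFormula₂ subS (ts 0) (ts 1),
      Relations.boundedFormula₂ subS (ts 0) (ts 1))]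
  | _, Rel.atm, ts => [(Relations.boundedFormula₁ atmS (ts 0), ts 0 =' botS.term),
      (ts 0 =' botS.term, Relations.boundedFormula₁ atmS (ts 0))]
  | _, Rel.lt, ts => [(∼(ts 0 =' botS.term), ∼(ts 1 =' botS.term)),
      (Relations.boundedFormula₂ ltS (ts 0) (ts 1), ⊤),
      (⊤, Relations.boundedFormula₂ ltS (ts 0) (ts 1))]

/-- Decomposition of a formula over a concatenation into a finite union of rectangles. -/
def rects {α : Type w} : {n : ℕ} → lang.BoundedFormula α n → Rects α n
  | _, .falsum => []
  | _, .equal s t => [(s =' t, s =' t)]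
  | _, .rel R ts => rectsRel R ts
  | _, .imp φ ψ => (rects φ).neg ++ rects ψ
  -- `∀` is `¬∃¬`: existential quantification commutes with unions, and the projection of a
  -- rectangle is the rectangle of the projections.
  | _, .all φ => Rects.neg ((rects φ).neg.map fun p => (∃' p.1, ∃' p.2))

variable {M : Type u₁} {N : Type u₂} [lang.Structure M] [lang.Structure N]

/-- Membership in a finite union of rectangles. -/
def Rects.Holds (l : Rects α n) (v : α → M) (xs : Fin n → M) (w : α → N) (ys : Fin n → N) : Prop :=
  ∃ p ∈ l, p.1.Realize v xs ∧ p.2.Realize w ys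

theorem Rects.holds_cons {p} {l : Rects α n} {v : α → M} {xs : Fin n → M} {w : α → N}
    {ys : Fin n → N} :
    Rects.Holds (p :: l) v xs w ys ↔ (p.1.Realize v xs ∧ p.2.Realize w ys) ∨ l.Holds v xs w ys := by
  simp only [Rects.Holds, List.exists_mem_cons_iff]

theorem Rects.holds_nil {v : α → M} {xs : Fin n → M} {w : α → N}
    {ys : Fin n → N} : ¬ Rects.Holds ([] : Rects α n) v xs w ys := by
  simp [Rects.Holds]

theorem Rects.holds_append {k l : Rects α n} {v : α → M} {xs : Fin n → M} {w : α → N}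
    {ys : Fin n → N} :
    Rects.Holds (k ++ l) v xs w ys ↔ k.Holds v xs w ys ∨ l.Holds v xs w ys := by
  simp only [Rects.Holds, List.mem_append, or_and_right, exists_or]

theorem Rects.holds_neg {l : Rects α n} {v : α → M} {xs : Fin n → M} {w : α → N}
    {ys : Fin n → N} : l.neg.Holds v xs w ys ↔ ¬ l.Holds v xs w ys := by
  induction l with
  | nil => simp [Rects.Holds, Rects.neg]
  | cons p l ih =>
    rw [Rects.holds_cons, not_or, ← ih, Rects.neg, Rects.holds_append]
    simp only [Rects.Holds, List.mem_map, exists_exists_and_eq_and, BoundedFormula.realize_inf,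
      BoundedFormula.realize_not]
    constructor
    · rintro (⟨q, hq, ⟨h1, h2⟩, h3⟩ | ⟨q, hq, h1, h2, h3⟩)
      · exact ⟨fun h => h2 h.1, q, hq, h1, h3⟩
      · exact ⟨fun h => h3 h.2, q, hq, h1, h2⟩
    · rintro ⟨h, q, hq, h1, h2⟩
      by_cases hp : p.1.Realize v xs
      · exact Or.inr ⟨q, hq, h1, h2, fun h' => h ⟨hp, h'⟩⟩
      · exact Or.inl ⟨q, hq, ⟨h1, hp⟩, h2⟩

theorem realize_term_concat {β : Type*} (t : lang.Term β) (v : β → Concat M N) :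
    t.realize v = .mk (t.realize (fun i => (v i).fst)) (t.realize (fun i => (v i).snd)) := by
  induction t with
  | var _ => rfl
  | @func l f ts _ =>
    induction l, f using functions_cases with
    | bot => rw [realize_term_botE, realize_term_botE, realize_term_botE]; rfl

section

omit [lang.Structure M] [lang.Structure N]

theorem sumElim_fst (v : α → Concat M N) (xs : Fin n → Concat M N) :
    (fun i => (Sum.elim v xs i).fst) = Sum.elim (fun i => (v i).fst) (fun i => (xs i).fst) := by
  ext i; cases i <;> rfl

theorem sumElim_snd (v : α → Concat M N) (xs : Fin n → Concat M N) :
    (fun i => (Sum.elim v xs i).snd) = Sum.elim (fun i => (v i).snd) (fun i => (xs i).snd) := by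
  ext i; cases i <;> rfl

theorem snoc_fst (xs : Fin n → Concat M N) (a : Concat M N) :
    (fun i => (Fin.snoc (α := fun _ => Concat M N) xs a i).fst) =
      Fin.snoc (α := fun _ => M) (fun i => (xs i).fst) a.fst := by
  ext i; refine Fin.lastCases ?_ (fun j => ?_) i <;> simp

theorem snoc_snd (xs : Fin n → Concat M N) (a : Concat M N) :
    (fun i => (Fin.snoc (α := fun _ => Concat M N) xs a i).snd) =
      Fin.snoc (α := fun _ => N) (fun i => (xs i).snd) a.snd := by
  ext i; refine Fin.lastCases ?_ (fun j => ?_) i <;> simp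

end

theorem realize_rectsRel (hM : Pre M) (hN : Pre N) {l : ℕ} (R : lang.Relations l)
    (ts : Fin l → lang.Term (α ⊕ Fin n)) (v : α → Concat M N) (xs : Fin n → Concat M N) :
    (R.boundedFormula ts).Realize v xs ↔ (rectsRel R ts).Holds
      (fun i => (v i).fst) (fun i => (xs i).fst) (fun i => (v i).snd) (fun i => (xs i).snd) := by
  rw [BoundedFormula.realize_rel]
  induction l, R using relations_cases with
  | sub =>
    rw [show rectsRel subS ts = [_] from rfl, relMap_sub]
    simp only [realize_term_concat, sumElim_fst, sumElim_snd, Rects.holds_nil, or_false,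
      Rects.holds_cons, BoundedFormula.realize_rel₂, subE_concat, Concat.fst_mk, Concat.snd_mk]
    rfl
  | atm =>
    rw [show rectsRel atmS ts = [_, _] from rfl, relMap_atm]
    simp only [realize_term_concat, sumElim_fst, sumElim_snd, Rects.holds_nil, or_false,
      Rects.holds_cons, BoundedFormula.realize_rel₁, atE_concat hM hN, Concat.fst_mk,
      Concat.snd_mk, BoundedFormula.realize_bdEqual, Term.realize_constants]
    rfl
  | lt =>
    rw [show rectsRel ltS ts = [_, _, _] from rfl, relMap_lt]
    simp only [realize_term_concat, sumElim_fst, sumElim_snd, Rects.holds_nil, or_false,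
      Rects.holds_cons, BoundedFormula.realize_rel₂, ltE_concat, Concat.fst_mk,
      Concat.snd_mk, BoundedFormula.realize_bdEqual, Term.realize_constants,
      BoundedFormula.realize_not, BoundedFormula.realize_top, and_true, true_and]
    rfl

/-- Composition theorem of Feferman–Vaught type: finite unions of rectangles are closed under
complement and projection. The list `rects φ` does not depend on `M` and `N`; this uniformity is
what all later applications rely on. -/
theorem realize_rects (hM : Pre M) (hN : Pre N) (φ : lang.BoundedFormula α n)
    (v : α → Concat M N) (xs : Fin n → Concat M N) : φ.Realize v xs ↔ (rects φ).Holds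
      (fun i => (v i).fst) (fun i => (xs i).fst) (fun i => (v i).snd) (fun i => (xs i).snd) := by
  induction φ with
  | falsum => exact (iff_false_intro id).trans (iff_false_intro Rects.holds_nil).symm
  | equal s t =>
    simp only [rects, Rects.holds_cons, Rects.holds_nil, or_false, BoundedFormula.realize_bdEqual]
    simp only [BoundedFormula.Realize, realize_term_concat, sumElim_fst, sumElim_snd]
    exact Concat.ext_iff
  | rel R ts => exact realize_rectsRel hM hN R ts v xs
  | imp φ ψ ih₁ ih₂ =>
    rw [BoundedFormula.realize_imp, ih₁, ih₂, rects, Rects.holds_append,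
      Rects.holds_neg, imp_iff_not_or]
  | all φ ih =>
    rw [BoundedFormula.realize_all, rects, Rects.holds_neg]
    simp only [ih, snoc_fst, snoc_snd]
    rw [← not_exists_not, not_iff_not]
    simp only [← Rects.holds_neg]
    simp only [Rects.Holds, List.mem_map, exists_exists_and_eq_and, BoundedFormula.realize_ex]
    constructor
    · rintro ⟨a, p, hp, h1, h2⟩
      exact ⟨p, hp, ⟨_, h1⟩, ⟨_, h2⟩⟩
    · rintro ⟨p, hp, ⟨a, h1⟩, ⟨b, h2⟩⟩
      exact ⟨.mk a b, p, hp, h1, h2⟩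

theorem realize_sentence_concat (hM : Pre M) (hN : Pre N) (φ : lang.Sentence) :
    Concat M N ⊨ φ ↔ ∃ p ∈ rects φ, M ⊨ p.1 ∧ N ⊨ p.2 := by
  rw [Sentence.Realize, Formula.Realize, realize_rects hM hN, Rects.Holds]
  simp only [Sentence.Realize, Formula.Realize]
  constructor <;> rintro ⟨p, hp, h3, h4⟩ <;> refine ⟨p, hp, ?_, ?_⟩
  · convert h3
  · convert h4
  · convert h3
  · convert h4

end Decomposition

/-! ### Isomorphisms -/

section Iso

variable {M : Type u₁} {N : Type u₂} {K : Type u₃} [lang.Structure M] [lang.Structure N]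
  [lang.Structure K]

/-- `M` and `N` satisfy the same sentences. -/
def ElemEq (M : Type u₁) (N : Type u₂) [lang.Structure M] [lang.Structure N] : Prop :=
  ∀ φ : lang.Sentence, M ⊨ φ ↔ N ⊨ φ

theorem ElemEq.symm (h : ElemEq M N) : ElemEq N M := fun φ => (h φ).symm

/-- In a `Pre` structure `⊆` determines equality, `⊥` and `At`, so a surjection respecting `⊆` and
`◁` in both directions is already an isomorphism. -/
theorem elemEq_of_surjective (hM : Pre M) (hN : Pre N) (f : M → N)
    (hsub : ∀ a b, SubE (f a) (f b) ↔ SubE a b) (hlt : ∀ a b, LtE (f a) (f b) ↔ LtE a b)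
    (hf : Function.Surjective f) : ElemEq M N := by
  have hinj : Function.Injective f := fun a b h =>
    hM.antisymm _ _ ((hsub _ _).1 (h ▸ hN.refl _)) ((hsub _ _).1 (h ▸ hN.refl _))
  have hbot : f (botE M) = botE N := by
    obtain ⟨c, hc⟩ := hf (botE N)
    rw [← hN.sub_bot, ← hc, hsub]
    exact hM.bot_sub _
  have hat : ∀ a, AtE (f a) ↔ AtE a := fun a => by
    rw [hN.at_iff, hM.at_iff, hf.forall]
    simp only [← hbot, hsub, hinj.eq_iff, Ne]
  have hfun : ∀ (l : ℕ) (g : lang.Functions l) (x : Fin l → M),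
      f (Structure.funMap g x) = Structure.funMap g (f ∘ x) := by
    intro l g
    induction l, g using functions_cases with
    | bot =>
      exact fun x => (congrArg f (funMap_eq_botE _ _)).trans
        (hbot.trans (funMap_eq_botE _ _).symm)
  have hrel : ∀ (l : ℕ) (r : lang.Relations l) (x : Fin l → M),
      Structure.RelMap r (f ∘ x) ↔ Structure.RelMap r x := fun l r => by
    induction l, r using relations_cases with
    | sub => exact fun x => (relMap_sub _).trans ((hsub _ _).trans (relMap_sub _).symm)
    | lt => exact fun x => (relMap_lt _).trans ((hlt _ _).trans (relMap_lt _).symm)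
    | atm => exact fun x => (relMap_atm _).trans ((hat _).trans (relMap_atm _).symm)
  let e : M ≃[lang] N :=
    { Equiv.ofBijective f ⟨hinj, hf⟩ with
      map_fun' := fun g x => hfun _ g x
      map_rel' := fun r x => hrel _ r x }
  exact fun φ => StrongHomClass.realize_sentence e φ

theorem ElemEq.concat {M' : Type*} {N' : Type*} [lang.Structure M'] [lang.Structure N']
    (hM : Pre M) (hN : Pre N) (hM' : Pre M') (hN' : Pre N')
    (h : ElemEq M M') (h' : ElemEq N N') : ElemEq (Concat M N) (Concat M' N') := fun φ => by
  rw [realize_sentence_concat hM hN, realize_sentence_concat hM' hN']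
  simp only [h _, h' _]

theorem elemEq_concat_assoc (hM : Pre M) (hN : Pre N) (hK : Pre K) :
    ElemEq (Concat (Concat M N) K) (Concat M (Concat N K)) := by
  refine elemEq_of_surjective ((hM.concat hN).concat hK) (hM.concat (hN.concat hK))
    (fun p => .mk p.fst.fst (.mk p.fst.snd p.snd)) (fun a b => ?_) (fun a b => ?_) ?_
  · simp only [subE_concat, and_assoc, Concat.fst_mk, Concat.snd_mk]
  · simp only [ltE_concat, Concat.fst_mk, Concat.snd_mk, fst_botE, snd_botE, Ne, Concat.ext_iff]
    tauto
  · exact fun p => ⟨.mk (.mk p.fst p.snd.fst) p.snd.snd, rfl⟩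

end Iso

/-! ### Finite models -/

/-- The subsets of a finite linear order with `n` elements. -/
@[ext] structure PowS (n : ℕ) where
  /-- The underlying set. -/
  set : Set (Fin n)

instance (n : ℕ) : lang.Structure (PowS n) where
  funMap {_} f _ := match f with
    | Func.bot => ⟨∅⟩
  RelMap {_} r := match r with
    | Rel.sub => fun x => (x 0).set ⊆ (x 1).set
    | Rel.atm => fun x => ∃ i, (x 0).set = {i}
    | Rel.lt => fun x => ∃ i ∈ (x 0).set, ∃ j ∈ (x 1).set, i < j

section PowS

variable {n m : ℕ}

theorem subE_powS {a b : PowS n} : SubE a b ↔ a.set ⊆ b.set := Iff.rfl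

theorem ltE_powS {a b : PowS n} : LtE a b ↔ ∃ i ∈ a.set, ∃ j ∈ b.set, i < j := Iff.rfl

theorem atE_powS {a : PowS n} : AtE a ↔ ∃ i, a.set = {i} := Iff.rfl

theorem botE_powS : botE (PowS n) = ⟨∅⟩ := rfl

theorem pre_powS (n : ℕ) : Pre (PowS n) where
  refl _ := subE_powS.2 Set.Subset.rfl
  antisymm _ _ h h' := PowS.ext (Set.Subset.antisymm h h')
  bot_sub a := Set.empty_subset a.set
  at_iff a := by
    simp only [atE_powS, botE_powS, subE_powS, PowS.ext_iff, Ne]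
    constructor
    · rintro ⟨i, hi⟩
      rw [hi]
      exact ⟨Set.singleton_ne_empty i, fun b hb => Set.subset_singleton_iff_eq.1 hb⟩
    · rintro ⟨h0, h⟩
      obtain ⟨i, hi⟩ := Set.nonempty_iff_ne_empty.2 h0
      exact ⟨i, ((h ⟨{i}⟩ (Set.singleton_subset_iff.2 hi)).resolve_left
        (Set.singleton_ne_empty i)).symm⟩

theorem castAdd_lt_natAdd (n m : ℕ) (i : Fin n) (j : Fin m) : Fin.castAdd m i < Fin.natAdd n j :=
  Fin.lt_def.2 (by simp only [Fin.val_castAdd, Fin.val_natAdd]; omega)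

/-- A subset of `Fin (n + m)` is the pair of its traces on the first `n` and the last `m` points.
Thus concatenation of finite models is addition of sizes. -/
theorem elemEq_powS_add (n m : ℕ) : ElemEq (PowS (n + m)) (Concat (PowS n) (PowS m)) := by
  refine elemEq_of_surjective (pre_powS _) ((pre_powS _).concat (pre_powS _))
    (fun a => .mk ⟨Fin.castAdd m ⁻¹' a.set⟩ ⟨Fin.natAdd n ⁻¹' a.set⟩)
    (fun a b => ?_) (fun a b => ?_) ?_
  · rw [subE_concat, subE_powS, subE_powS, subE_powS]
    constructor
    · rintro ⟨h1, h2⟩ i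
      exact Fin.addCases (fun j hj => h1 hj) (fun j hj => h2 hj) i
    · exact fun h => ⟨Set.preimage_mono h, Set.preimage_mono h⟩
  · simp only [ltE_concat, ltE_powS, botE_powS, Ne, PowS.ext_iff, Concat.fst_mk, Concat.snd_mk]
    rw [← Ne, ← Ne, ← Set.nonempty_iff_ne_empty, ← Set.nonempty_iff_ne_empty]
    constructor
    · rintro (⟨⟨i, hi⟩, ⟨j, hj⟩⟩ | ⟨i, hi, j, hj, h⟩ | ⟨i, hi, j, hj, h⟩)
      · exact ⟨_, hi, _, hj, castAdd_lt_natAdd n m i j⟩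
      · exact ⟨_, hi, _, hj, h⟩
      · exact ⟨_, hi, _, hj, (Fin.natAdd_lt_natAdd_iff n).2 h⟩
    · rintro ⟨i, hi, j, hj, h⟩
      induction i using Fin.addCases with
      | left i =>
        induction j using Fin.addCases with
        | left j => exact Or.inr (Or.inl ⟨i, hi, j, hj, h⟩)
        | right j => exact Or.inl ⟨⟨i, hi⟩, ⟨j, hj⟩⟩
      | right i =>
        induction j using Fin.addCases with
        | left j => exact absurd h (not_lt_of_gt (castAdd_lt_natAdd n m j i))
        | right j => exact Or.inr (Or.inr ⟨i, hi, j, hj, (Fin.natAdd_lt_natAdd_iff n).1 h⟩)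
  · intro p
    refine ⟨⟨{k : Fin (n + m) | Fin.addCases (motive := fun _ => Prop) (fun i => i ∈ p.fst.set)
      (fun i => i ∈ p.snd.set) k}⟩, Concat.ext (PowS.ext ?_) (PowS.ext ?_)⟩
    · ext i; simp
    · ext i; simp

end PowS

/-! ### Semantic form of the theory -/

section Semantic

variable {M : Type u₁} [lang.Structure M]

/-- `c` is a join of `a` and `b`. -/
def JoinE (a b c : M) : Prop := SubE a c ∧ SubE b c ∧ ∀ d, SubE a d → SubE b d → SubE c d

/-- `c` is a meet of `a` and `b`. -/
def MeetE (a b c : M) : Prop := SubE c a ∧ SubE c b ∧ ∀ d, SubE d a → SubE d b → SubE d c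

section

variable {n : ℕ} (e : Empty → M) (xs : Fin n → M)

@[simp] theorem realize_isJoin (i j k : Fin n) :
    (isJoin i j k).Realize e xs ↔ JoinE (xs i) (xs j) (xs k) := by
  simp [isJoin, JoinE, and_assoc]

@[simp] theorem realize_isMeet (i j k : Fin n) :
    (isMeet i j k).Realize e xs ↔ MeetE (xs i) (xs j) (xs k) := by
  simp [isMeet, MeetE, and_assoc]

@[simp] theorem realize_isLeast (k : Fin n) :
    (isLeast k).Realize e xs ↔ ∀ d, SubE (xs k) d := by
  simp [isLeast]

@[simp] theorem realize_isGreatest (k : Fin n) :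
    (isGreatest k).Realize e xs ↔ ∀ d, SubE d (xs k) := by
  simp [isGreatest]

@[simp] theorem realize_isMinNonBot (k : Fin n) : (isMinNonBot k).Realize e xs ↔
    xs k ≠ botE M ∧ ∀ d, SubE d (xs k) → d = botE M ∨ d = xs k := by
  simp [isMinNonBot]

end

theorem realize_comp {n : ℕ} (η : lang.Formula (Fin (n + 1))) : M ⊨ comp η ↔
    ∀ b : Fin n → M, ∃ X, ∀ x, AtE x → (SubE x X ↔ η.Realize (Fin.cons x b : Fin (n + 1) → M)) := by
  rw [comp, Sentence.Realize, BoundedFormula.realize_alls]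
  refine forall_congr' fun b => ?_
  rw [BoundedFormula.realize_ex]
  refine exists_congr fun X => ?_
  rw [realize_allAt]
  refine forall_congr' fun x => forall_congr' fun _ => ?_
  rw [BoundedFormula.realize_iff, realize_subF, BoundedFormula.realize_relabel]
  refine iff_congr (by simp) ?_
  -- The two sides differ only in the presentation of the free valuation and in an empty tuple of
  -- bound variables.
  have h : ∀ (v w : Fin (n + 1) → M) (xs ys : Fin 0 → M), v = w →
      (BoundedFormula.Realize η v xs ↔ BoundedFormula.Realize η w ys) := by
    rintro v w xs ys rfl
    rw [Subsingleton.elim xs ys]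
  refine h _ _ _ _ (funext fun i => ?_)
  refine Fin.cases ?_ (fun j => ?_) i
  · simp [Fin.snoc]
  · simp [Fin.snoc]

/-- Semantic form of the theory `T_MSO(Fin)`. -/
structure Good (M : Type u₁) [lang.Structure M] : Prop extends Pre M where
  trans : ∀ a b c : M, SubE a b → SubE b c → SubE a c
  sep : ∀ a b : M, (∀ x, AtE x → SubE x a → SubE x b) → SubE a b
  lt_irrefl : ∀ x : M, AtE x → ¬ LtE x x
  lt_trans : ∀ x y z : M, AtE x → AtE y → AtE z → LtE x y → LtE y z → LtE x z
  lt_total : ∀ x y : M, AtE x → AtE y → LtE x y ∨ x = y ∨ LtE y x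
  lt_iff : ∀ a b : M, LtE a b ↔ ∃ x y, AtE x ∧ AtE y ∧ SubE x a ∧ SubE y b ∧ LtE x y
  comp : ∀ (n : ℕ) (η : lang.Formula (Fin (n + 1))) (b : Fin n → M), ∃ X, ∀ x, AtE x →
    (SubE x X ↔ η.Realize (Fin.cons x b : Fin (n + 1) → M))
  least : ∀ a : M, a ≠ botE M → ∃ x, AtE x ∧ SubE x a ∧ ∀ y, AtE y → SubE y a → y = x ∨ LtE x y
  greatest : ∀ a : M, a ≠ botE M → ∃ x, AtE x ∧ SubE x a ∧ ∀ y, AtE y → SubE y a → y = x ∨ LtE y x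

/-- Two fields need an argument beyond rearranging axioms: `sep`, from atomicity and complements,
and `greatest`, which is dual to an axiom but is not one itself. -/
theorem good_of_model (h : M ⊨ TMSOFin) : Good M := by
  rw [TMSOFin, Theory.model_union_iff, Tbase, Theory.model_union_iff, Theory.model_union_iff] at h
  obtain ⟨⟨⟨hb, ha⟩, hc⟩, hf⟩ := h
  simp only [booleanAxioms, Theory.model_insert_iff, Theory.model_singleton_iff] at hb
  simp [Sentence.Realize, Formula.Realize, Fin.snoc] at hb
  simp only [atomAxioms, Theory.model_insert_iff, Theory.model_singleton_iff] at ha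
  simp [Sentence.Realize, Formula.Realize, Fin.snoc] at ha
  simp only [finAxioms, Theory.model_insert_iff, Theory.model_singleton_iff] at hf
  simp [Sentence.Realize, Formula.Realize, Fin.snoc] at hf
  obtain ⟨refl, trans, antisymm, -, -, join, meet, distrib, compl⟩ := hb
  obtain ⟨bot_sub, at_iff, atomic, irrefl, ltrans, total, lt_iff⟩ := ha
  obtain ⟨-, last, -, pred, least⟩ := hf
  have hcomp : ∀ (n : ℕ) (η : lang.Formula (Fin (n + 1))) (b : Fin n → M), ∃ X, ∀ x, AtE x →
      (SubE x X ↔ η.Realize (Fin.cons x b : Fin (n + 1) → M)) := fun n η =>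
    (realize_comp η).1 (hc.realize_of_mem _ ⟨n, η, rfl⟩)
  have hpre : Pre M := ⟨refl, antisymm, bot_sub, at_iff⟩
  have hltiff : ∀ a b : M, LtE a b ↔
      ∃ x y, AtE x ∧ AtE y ∧ SubE x a ∧ SubE y b ∧ LtE x y := fun a b => by
    rw [lt_iff]
    constructor
    · rintro ⟨x, hx, y, hy, ⟨h1, h2⟩, h3⟩
      exact ⟨x, y, hx, hy, h1, h2, h3⟩
    · rintro ⟨x, y, hx, hy, h1, h2, h3⟩
      exact ⟨x, hx, y, hy, ⟨h1, h2⟩, h3⟩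
  have hleast : ∀ a : M, a ≠ botE M →
      ∃ x, AtE x ∧ SubE x a ∧ ∀ y, AtE y → SubE y a → y = x ∨ LtE x y := fun a h0 => by
    obtain ⟨x, hx, hxa, h1⟩ := least a h0
    refine ⟨x, hx, hxa, fun y hy hya => ?_⟩
    rcases total x hx y hy with (h2 | h2) | h2
    · exact Or.inr h2
    · exact Or.inl h2.symm
    · exact absurd hya (h1 y hy h2)
  refine ⟨hpre, trans, fun a b hab => ?_, irrefl,
    fun x y z hx hy hz => ltrans x hx y hy z hz,
    fun x y hx hy => or_assoc.1 (total x hx y hy), hltiff, hcomp, hleast, fun a h0 => ?_⟩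
  -- With `b'` a complement of `b`, distributivity puts `a` below the join of `a ∩ b` and `a ∩ b'`;
  -- the latter is `⊥`, since an atom in it would lie in both `b` and `b'`.
  · obtain ⟨b', h1, h2⟩ := compl b
    obtain ⟨j, hj⟩ := join b b'
    obtain ⟨p, hp⟩ := meet a j
    obtain ⟨q, hq⟩ := meet a b
    obtain ⟨r, hr⟩ := meet a b'
    obtain ⟨s, hs⟩ := join q r
    have h3 := distrib a b b' j p q r s hj hp hq hr hs
    obtain ⟨m, hm⟩ := meet b b'
    have hr0 : r = botE M := by
      by_contra hr0
      obtain ⟨x, hx, hxr⟩ := atomic r hr0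
      have h4 := hm.2.2 x (hab x hx (trans _ _ _ hxr hr.1)) (trans _ _ _ hxr hr.2.1)
      exact hpre.ne_bot hx (hpre.sub_bot.1 (trans _ _ _ h4 (h1 m hm _)))
    have h4 : SubE s b := hs.2.2 b hq.2.1 (hr0 ▸ bot_sub b)
    exact trans _ _ _ (hp.2.2 a (refl a) (h2 j hj a)) (trans _ _ _ h3 h4)
  · obtain ⟨x₀, hx₀, hx₀a⟩ := atomic a h0
    obtain ⟨l, hl, hl'⟩ := last x₀ hx₀
    -- `U` is the set of atoms that bound `a` from above. It contains the last atom `l`, so it has a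
    -- least element `u`, the candidate for the greatest atom of `a`.
    obtain ⟨U, hU⟩ := hcomp 1 (∀' ((atmS.boundedFormula₁ (Term.var (Sum.inr 0)) ⊓
      subS.boundedFormula₂ (Term.var (Sum.inr 0)) (Term.var (Sum.inl 1))) ⟹
      ((Term.var (Sum.inr 0) : lang.Term (Fin 2 ⊕ Fin 1)) =' (Term.var (Sum.inl 0)) ⊔
        ltS.boundedFormula₂ (Term.var (Sum.inr 0)) (Term.var (Sum.inl 0))))) ![a]
    have hU' : ∀ x, AtE x → (SubE x U ↔ ∀ y, AtE y → SubE y a → y = x ∨ LtE y x) := fun x hx => by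
      rw [hU x hx, Formula.Realize, BoundedFormula.realize_all]
      refine forall_congr' fun y => ?_
      simp only [BoundedFormula.realize_imp, BoundedFormula.realize_inf,
        BoundedFormula.realize_sup, BoundedFormula.realize_rel₁, BoundedFormula.realize_rel₂,
        BoundedFormula.realize_bdEqual, Term.realize_var, Sum.elim_inl, Sum.elim_inr, and_imp]
      rfl
    have hlU : SubE l U := (hU' l hl).2 fun y hy _ => hl' y hy
    obtain ⟨u, hu, huU, hu'⟩ := hleast U fun h => hpre.ne_bot hl (hpre.sub_bot.1 (h ▸ hlU))
    have hu2 := (hU' u hu).1 huU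
    by_cases hua : SubE u a
    · exact ⟨u, hu, hua, hu2⟩
    have hx₀u : LtE x₀ u := (hu2 x₀ hx₀ hx₀a).resolve_left fun h => hua (h ▸ hx₀a)
    -- If `u` were not in `a`, its immediate predecessor would be a smaller upper bound of `a`.
    obtain ⟨w, hw, hwu, hw'⟩ := pred u hu x₀ hx₀ hx₀u
    have hwU : SubE w U := (hU' w hw).2 fun y hy hya => by
      have hyu : LtE y u := (hu2 y hy hya).resolve_left fun h => hua (h ▸ hya)
      rcases total y hy w hw with (h | h) | h
      · exact Or.inr h
      · exact Or.inl h
      · exact absurd hyu (hw' y hy h)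
    rcases hu' w hw hwU with h | h
    · exact absurd (h ▸ hwu) (irrefl u hu)
    · exact absurd (ltrans _ hu _ hw _ hu h hwu) (irrefl u hu)

end Semantic

-- Boolean operations obtained from comprehension, and recovery of the axioms.

section Consequences

variable {M : Type u₁} [lang.Structure M]

theorem Good.not_lt_bot (h : Good M) (a : M) : ¬ LtE a (botE M) := fun h' => by
  obtain ⟨x, y, -, hy, -, hy', -⟩ := (h.lt_iff _ _).1 h'
  exact h.ne_bot hy (h.sub_bot.1 hy')

theorem Good.not_bot_lt (h : Good M) (a : M) : ¬ LtE (botE M) a := fun h' => by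
  obtain ⟨x, y, hx, -, hx', -⟩ := (h.lt_iff _ _).1 h'
  exact h.ne_bot hx (h.sub_bot.1 hx')

theorem Good.ext (h : Good M) {a b : M} (h' : ∀ x, AtE x → (SubE x a ↔ SubE x b)) : a = b :=
  h.antisymm _ _ (h.sep _ _ fun x hx => (h' x hx).1) (h.sep _ _ fun x hx => (h' x hx).2)

theorem Good.exists_at (h : Good M) {a : M} (ha : a ≠ botE M) : ∃ x, AtE x ∧ SubE x a :=
  let ⟨x, hx, hxa, _⟩ := h.least a ha
  ⟨x, hx, hxa⟩

theorem Good.at_sub_bot (h : Good M) {x : M} (hx : AtE x) : ¬ SubE x (botE M) :=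
  fun h' => h.ne_bot hx (h.sub_bot.1 h')

theorem Good.lt_asymm (h : Good M) {x y : M} (hx : AtE x) (hy : AtE y) (hxy : LtE x y) :
    ¬ LtE y x := fun hyx => h.lt_irrefl x hx (h.lt_trans _ _ _ hx hy hx hxy hyx)

theorem Good.at_sub_at (h : Good M) {x y : M} (hx : AtE x) (hy : AtE y) : SubE x y ↔ x = y :=
  ⟨h.eq_of_at hx hy, fun h' => h' ▸ h.refl _⟩

theorem Good.exists_union (h : Good M) (a b : M) :
    ∃ X, ∀ x, AtE x → (SubE x X ↔ SubE x a ∨ SubE x b) := by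
  obtain ⟨X, hX⟩ := h.comp 2 (subS.formula₂ (Term.var 0) (Term.var 1) ⊔
    subS.formula₂ (Term.var 0) (Term.var 2)) ![a, b]
  refine ⟨X, fun x hx => (hX x hx).trans ?_⟩
  rw [Formula.realize_sup, Formula.realize_rel₂, Formula.realize_rel₂]
  rfl

theorem Good.exists_inter (h : Good M) (a b : M) :
    ∃ X, ∀ x, AtE x → (SubE x X ↔ SubE x a ∧ SubE x b) := by
  obtain ⟨X, hX⟩ := h.comp 2 (subS.formula₂ (Term.var 0) (Term.var 1) ⊓
    subS.formula₂ (Term.var 0) (Term.var 2)) ![a, b]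
  refine ⟨X, fun x hx => (hX x hx).trans ?_⟩
  rw [Formula.realize_inf, Formula.realize_rel₂, Formula.realize_rel₂]
  rfl

theorem Good.exists_compl (h : Good M) (a : M) :
    ∃ X, ∀ x, AtE x → (SubE x X ↔ ¬ SubE x a) := by
  obtain ⟨X, hX⟩ := h.comp 1 (∼(subS.formula₂ (Term.var 0) (Term.var 1))) ![a]
  refine ⟨X, fun x hx => (hX x hx).trans ?_⟩
  rw [Formula.realize_not, Formula.realize_rel₂]
  rfl

theorem Good.exists_gt (h : Good M) (a : M) :
    ∃ X, ∀ x, AtE x → (SubE x X ↔ LtE a x) := by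
  obtain ⟨X, hX⟩ := h.comp 1 (ltS.formula₂ (Term.var 1) (Term.var 0)) ![a]
  refine ⟨X, fun x hx => (hX x hx).trans ?_⟩
  rw [Formula.realize_rel₂]
  rfl

theorem Good.exists_lt (h : Good M) (a : M) :
    ∃ X, ∀ x, AtE x → (SubE x X ↔ LtE x a) := by
  obtain ⟨X, hX⟩ := h.comp 1 (ltS.formula₂ (Term.var 0) (Term.var 1)) ![a]
  refine ⟨X, fun x hx => (hX x hx).trans ?_⟩
  rw [Formula.realize_rel₂]
  rfl

theorem Good.exists_top (h : Good M) : ∃ X : M, ∀ a, SubE a X := by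
  obtain ⟨X, hX⟩ := h.exists_compl (botE M)
  exact ⟨X, fun a => h.sep _ _ fun x hx _ => (hX x hx).2 (h.at_sub_bot hx)⟩

/-- Comprehension provides the union of the two sets of atoms, and the join must lie below it. With
`Good.meetE_iff` this turns the Boolean algebra axioms into propositional tautologies about a single
atom. -/
theorem Good.joinE_iff (h : Good M) {a b c : M} :
    JoinE a b c ↔ ∀ x, AtE x → (SubE x c ↔ SubE x a ∨ SubE x b) := by
  constructor
  · rintro ⟨h1, h2, h3⟩ x hx
    obtain ⟨X, hX⟩ := h.exists_union a b
    have h4 : SubE c X := h3 X (h.sep _ _ fun y hy hya => (hX y hy).2 (Or.inl hya))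
      (h.sep _ _ fun y hy hyb => (hX y hy).2 (Or.inr hyb))
    exact ⟨fun h5 => (hX x hx).1 (h.trans _ _ _ h5 h4),
      fun h5 => h5.elim (fun h6 => h.trans _ _ _ h6 h1) fun h6 => h.trans _ _ _ h6 h2⟩
  · intro h1
    exact ⟨h.sep _ _ fun x hx hxa => (h1 x hx).2 (Or.inl hxa),
      h.sep _ _ fun x hx hxa => (h1 x hx).2 (Or.inr hxa),
      fun d h2 h3 => h.sep _ _ fun x hx hxc => ((h1 x hx).1 hxc).elim
        (fun h4 => h.trans _ _ _ h4 h2) fun h4 => h.trans _ _ _ h4 h3⟩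

theorem Good.meetE_iff (h : Good M) {a b c : M} :
    MeetE a b c ↔ ∀ x, AtE x → (SubE x c ↔ SubE x a ∧ SubE x b) := by
  constructor
  · rintro ⟨h1, h2, h3⟩ x hx
    exact ⟨fun h5 => ⟨h.trans _ _ _ h5 h1, h.trans _ _ _ h5 h2⟩, fun h5 => h3 x h5.1 h5.2⟩
  · intro h1
    exact ⟨h.sep _ _ fun x hx hxa => ((h1 x hx).1 hxa).1,
      h.sep _ _ fun x hx hxa => ((h1 x hx).1 hxa).2,
      fun d h2 h3 => h.sep _ _ fun x hx hxd =>
        (h1 x hx).2 ⟨h.trans _ _ _ hxd h2, h.trans _ _ _ hxd h3⟩⟩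

theorem Good.model_booleanAxioms (h : Good M) : M ⊨ booleanAxioms := by
  simp only [booleanAxioms, Theory.model_insert_iff, Theory.model_singleton_iff]
  simp [Sentence.Realize, Formula.Realize, Fin.snoc]
  obtain ⟨top, htop⟩ := h.exists_top
  refine ⟨h.refl, h.trans, h.antisymm, ⟨_, h.bot_sub⟩, ⟨_, htop⟩, fun a b => ?_, fun a b => ?_,
    fun x y z j p q r s hj hp hq hr hs => ?_, fun a => ?_⟩
  · exact (h.exists_union a b).imp fun c => h.joinE_iff.2
  · exact (h.exists_inter a b).imp fun c => h.meetE_iff.2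
  · rw [h.joinE_iff] at hj hs
    rw [h.meetE_iff] at hp hq hr
    refine h.sep _ _ fun t ht => ?_
    rw [hp t ht, hj t ht, hs t ht, hq t ht, hr t ht]
    tauto
  · obtain ⟨b, hb⟩ := h.exists_compl a
    refine ⟨b, fun c hc d => ?_, fun c hc d => ?_⟩
    · rw [h.meetE_iff] at hc
      refine h.sep _ _ fun x hx hxc => absurd ((hc x hx).1 hxc) ?_
      rw [hb x hx]
      tauto
    · rw [h.joinE_iff] at hc
      refine h.sep _ _ fun x hx _ => (hc x hx).2 ?_
      rw [hb x hx]
      tauto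

theorem Good.model_atomAxioms (h : Good M) : M ⊨ atomAxioms := by
  simp only [atomAxioms, Theory.model_insert_iff, Theory.model_singleton_iff]
  simp [Sentence.Realize, Formula.Realize, Fin.snoc]
  refine ⟨h.bot_sub, h.at_iff, fun a => h.exists_at, h.lt_irrefl,
    fun x hx y hy z hz => h.lt_trans _ _ _ hx hy hz,
    fun x hx y hy => or_assoc.2 (h.lt_total x y hx hy), fun a b => ?_⟩
  rw [h.lt_iff]
  constructor
  · rintro ⟨x, y, hx, hy, h1, h2, h3⟩
    exact ⟨x, hx, y, hy, ⟨h1, h2⟩, h3⟩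
  · rintro ⟨x, hx, y, hy, ⟨h1, h2⟩, h3⟩
    exact ⟨x, y, hx, hy, h1, h2, h3⟩

theorem Good.model_finAxioms (h : Good M) : M ⊨ finAxioms := by
  simp only [finAxioms, Theory.model_insert_iff, Theory.model_singleton_iff]
  simp [Sentence.Realize, Formula.Realize, Fin.snoc]
  obtain ⟨top, htop⟩ := h.exists_top
  have htop0 : ∀ x : M, AtE x → top ≠ botE M := fun x hx h0 => h.at_sub_bot hx (h0 ▸ htop x)
  refine ⟨fun a ha => ?_, fun a ha => ?_, fun a ha b hb hab => ?_, fun a ha b hb hba => ?_,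
    fun a ha => ?_⟩
  · obtain ⟨x, hx, -, hx'⟩ := h.least top (htop0 a ha)
    exact ⟨x, hx, fun y hy => hx' y hy (htop y)⟩
  · obtain ⟨x, hx, -, hx'⟩ := h.greatest top (htop0 a ha)
    exact ⟨x, hx, fun y hy => hx' y hy (htop y)⟩
  · obtain ⟨X, hX⟩ := h.exists_gt a
    obtain ⟨x, hx, hxX, hx'⟩ := h.least X fun h0 => h.at_sub_bot hb (h0 ▸ (hX b hb).2 hab)
    refine ⟨x, hx, (hX x hx).1 hxX, fun y hy hay hyx => ?_⟩
    rcases hx' y hy ((hX y hy).2 hay) with rfl | h1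
    · exact h.lt_irrefl _ hy hyx
    · exact h.lt_asymm hx hy h1 hyx
  · obtain ⟨X, hX⟩ := h.exists_lt a
    obtain ⟨x, hx, hxX, hx'⟩ := h.greatest X fun h0 => h.at_sub_bot hb (h0 ▸ (hX b hb).2 hba)
    refine ⟨x, hx, (hX x hx).1 hxX, fun y hy hxy hya => ?_⟩
    rcases hx' y hy ((hX y hy).2 hya) with rfl | h1
    · exact h.lt_irrefl _ hy hxy
    · exact h.lt_asymm hy hx h1 hxy
  · obtain ⟨x, hx, hxa, hx'⟩ := h.least a ha
    refine ⟨x, hx, hxa, fun y hy hyx hya => ?_⟩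
    rcases hx' y hy hya with rfl | h1
    · exact h.lt_irrefl _ hy hyx
    · exact h.lt_asymm hx hy h1 hyx

/-- Needed to place concatenations and finite models, for which `Good` is checked directly, among
the models of `TMSOFin`. -/
theorem Good.model (h : Good M) : M ⊨ TMSOFin := by
  rw [TMSOFin, Theory.model_union_iff, Tbase, Theory.model_union_iff, Theory.model_union_iff]
  refine ⟨⟨⟨h.model_booleanAxioms, h.model_atomAxioms⟩, ?_⟩, h.model_finAxioms⟩
  rw [Theory.model_iff]
  rintro _ ⟨n, η, rfl⟩
  exact (realize_comp η).2 (h.comp n η)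

end Consequences

/-! ### Concatenations of models, finite models -/

section Concat

variable {M : Type u₁} {N : Type u₂} [lang.Structure M] [lang.Structure N]

theorem forall_at_concat (hM : Pre M) (hN : Pre N) {P : Concat M N → Prop} :
    (∀ p, AtE p → P p) ↔
      (∀ x, AtE x → P (.mk x (botE N))) ∧ ∀ y, AtE y → P (.mk (botE M) y) := by
  constructor
  · intro h
    exact ⟨fun x hx => h _ ((atE_concat hM hN).2 (Or.inl ⟨hx, rfl⟩)),
      fun y hy => h _ ((atE_concat hM hN).2 (Or.inr ⟨rfl, hy⟩))⟩
  · rintro ⟨h1, h2⟩ p hp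
    rcases (atE_concat hM hN).1 hp with ⟨hx, hy⟩ | ⟨hx, hy⟩
    · exact (Concat.ext rfl hy.symm : Concat.mk p.fst (botE N) = p) ▸ h1 _ hx
    · exact (Concat.ext hx.symm rfl : Concat.mk (botE M) p.snd = p) ▸ h2 _ hy

theorem atE_inl (hM : Pre M) (hN : Pre N) {x : M} (hx : AtE x) : AtE (Concat.mk x (botE N)) :=
  (atE_concat hM hN).2 (Or.inl ⟨hx, rfl⟩)

theorem atE_inr (hM : Pre M) (hN : Pre N) {y : N} (hy : AtE y) : AtE (Concat.mk (botE M) y) :=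
  (atE_concat hM hN).2 (Or.inr ⟨rfl, hy⟩)

-- At an atom `(x, ⊥)` the second side of each rectangle of `η` has a truth value independent of
-- `x`. Keeping the rectangles where it is true, the disjunction of their first sides is a formula
-- about `x` in `M`, and comprehension in `M` yields `X`; symmetrically for `Y`.
open Classical in
theorem Good.concat_comp (hM : Good M) (hN : Good N) (n : ℕ) (η : lang.Formula (Fin (n + 1)))
    (b : Fin n → Concat M N) : ∃ X : Concat M N, ∀ p, AtE p →
      (SubE p X ↔ η.Realize (Fin.cons p b : Fin (n + 1) → Concat M N)) := by
  have hfst : ∀ p : Concat M N, (fun i => ((Fin.cons p b : Fin (n + 1) → Concat M N) i).fst) =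
      Fin.cons p.fst fun i => (b i).fst := fun p => by
    ext i; refine Fin.cases ?_ (fun j => ?_) i <;> simp
  have hsnd : ∀ p : Concat M N, (fun i => ((Fin.cons p b : Fin (n + 1) → Concat M N) i).snd) =
      Fin.cons p.snd fun i => (b i).snd := fun p => by
    ext i; refine Fin.cases ?_ (fun j => ?_) i <;> simp
  have key : ∀ p : Concat M N, η.Realize (Fin.cons p b : Fin (n + 1) → Concat M N) ↔
      ∃ r ∈ rects η, Formula.Realize r.1 (Fin.cons p.fst fun i => (b i).fst : Fin (n + 1) → M) ∧
        Formula.Realize r.2 (Fin.cons p.snd fun i => (b i).snd : Fin (n + 1) → N) := fun p => by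
    rw [Formula.Realize, realize_rects hM.toPre hN.toPre, hfst, hsnd, Rects.Holds]
    simp only [Formula.Realize]
    have h1 : (fun i => ((default : Fin 0 → Concat M N) i).fst) = default := Subsingleton.elim _ _
    have h2 : (fun i => ((default : Fin 0 → Concat M N) i).snd) = default := Subsingleton.elim _ _
    rw [h1, h2]
  obtain ⟨X, hX⟩ := hM.comp n (((rects η).filter fun r => Formula.Realize r.2
    (Fin.cons (botE N) fun i => (b i).snd : Fin (n + 1) → N)).map Prod.fst |>.foldr (· ⊔ ·) ⊥)
    (fun i => (b i).fst)
  obtain ⟨Y, hY⟩ := hN.comp n (((rects η).filter fun r => Formula.Realize r.1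
    (Fin.cons (botE M) fun i => (b i).fst : Fin (n + 1) → M)).map Prod.snd |>.foldr (· ⊔ ·) ⊥)
    (fun i => (b i).snd)
  refine ⟨.mk X Y, (forall_at_concat hM.toPre hN.toPre).2 ⟨fun x hx => ?_, fun y hy => ?_⟩⟩
  · rw [subE_concat, key]
    simp only [Concat.fst_mk, Concat.snd_mk]
    rw [hX x hx, and_iff_left (hN.bot_sub Y), Formula.Realize, BoundedFormula.realize_foldr_sup]
    simp only [List.mem_map, List.mem_filter, decide_eq_true_eq]
    constructor
    · rintro ⟨_, ⟨r, ⟨hr, h1⟩, rfl⟩, h2⟩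
      exact ⟨r, hr, h2, h1⟩
    · rintro ⟨r, hr, h2, h1⟩
      exact ⟨_, ⟨r, ⟨hr, h1⟩, rfl⟩, h2⟩
  · rw [subE_concat, key]
    simp only [Concat.fst_mk, Concat.snd_mk]
    rw [hY y hy, and_iff_right (hM.bot_sub X), Formula.Realize, BoundedFormula.realize_foldr_sup]
    simp only [List.mem_map, List.mem_filter, decide_eq_true_eq]
    constructor
    · rintro ⟨_, ⟨r, ⟨hr, h1⟩, rfl⟩, h2⟩
      exact ⟨r, hr, h1, h2⟩
    · rintro ⟨r, hr, h1, h2⟩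
      exact ⟨_, ⟨r, ⟨hr, h1⟩, rfl⟩, h2⟩

theorem Good.inl_lt_inl (hN : Good N) {x x' : M} :
    LtE (Concat.mk x (botE N)) (Concat.mk x' (botE N)) ↔ LtE x x' := by
  simp [ltE_concat, hN.not_bot_lt]

theorem Good.inr_lt_inr (hM : Good M) {y y' : N} :
    LtE (Concat.mk (botE M) y) (Concat.mk (botE M) y') ↔ LtE y y' := by
  simp [ltE_concat, hM.not_bot_lt]

theorem Good.inl_lt_inr (hM : Good M) (hN : Good N) {x : M} {y : N} :
    LtE (Concat.mk x (botE N)) (Concat.mk (botE M) y) ↔ x ≠ botE M ∧ y ≠ botE N := by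
  simp [ltE_concat, hN.not_bot_lt, hM.not_lt_bot]

theorem Good.not_inr_lt_inl (hM : Good M) (hN : Good N) {x : M} {y : N} :
    ¬ LtE (Concat.mk (botE M) y) (Concat.mk x (botE N)) := by
  simp [ltE_concat, hM.not_bot_lt, hN.not_lt_bot]

theorem Good.concat (hM : Good M) (hN : Good N) : Good (Concat M N) := by
  have hall {P : Concat M N → Prop} := forall_at_concat hM.toPre hN.toPre (P := P)
  have e1 {x x' : M} := hN.inl_lt_inl (x := x) (x' := x')
  have e2 {y y' : N} := hM.inr_lt_inr (y := y) (y' := y')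
  have e3 {x y} := hM.inl_lt_inr hN (x := x) (y := y)
  have e4 {x y} := hM.not_inr_lt_inl hN (x := x) (y := y)
  have e5 {x : M} {x' : Concat M N} : SubE (Concat.mk x (botE N)) x' ↔ SubE x x'.fst := by
    simp [subE_concat, hN.bot_sub]
  have e6 {x : N} {x' : Concat M N} : SubE (Concat.mk (botE M) x) x' ↔ SubE x x'.snd := by
    simp [subE_concat, hM.bot_sub]
  have hirr : ∀ p : Concat M N, AtE p → ¬ LtE p p := by
    rw [hall]
    simp only [e1, e2]
    exact ⟨hM.lt_irrefl, hN.lt_irrefl⟩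
  have hl {x : M} (hx : AtE x) := atE_inl hM.toPre hN.toPre hx
  have hr {x : N} (hx : AtE x) := atE_inr hM.toPre hN.toPre hx
  refine ⟨hM.toPre.concat hN.toPre, fun a b c h1 h2 =>
    ⟨hM.trans _ _ _ h1.1 h2.1, hN.trans _ _ _ h1.2 h2.2⟩, fun a b => ?_, hirr, ?_, ?_, ?_,
    hM.concat_comp hN, fun a ha => ?_, fun a ha => ?_⟩
  · rw [hall]
    simp only [e5, e6]
    rintro ⟨h1, h2⟩
    exact ⟨hM.sep _ _ h1, hN.sep _ _ h2⟩
  -- Each quantifier is put next to its guard so that `hall` can split it into atoms of `M` and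
  -- atoms of `N`.
  · have : ∀ p : Concat M N, AtE p → ∀ q, AtE q → ∀ r, AtE r → LtE p q → LtE q r → LtE p r := by
      simp only [hall, e1, e2, e3, e4]
      refine ⟨fun x hx => ⟨fun x' hx' => ⟨fun x'' hx'' => hM.lt_trans _ _ _ hx hx' hx'',
        fun y hy _ _ => ⟨hM.ne_bot hx, hN.ne_bot hy⟩⟩, fun y hy => ⟨?_, ?_⟩⟩,
        fun y hy => ⟨?_, fun y' hy' => ⟨?_, fun y'' hy'' => hN.lt_trans _ _ _ hy hy' hy''⟩⟩⟩
      · exact fun _ _ _ h => h.elim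
      · exact fun z hz _ _ => ⟨hM.ne_bot hx, hN.ne_bot hz⟩
      · exact fun _ _ => ⟨fun _ _ h => h.elim, fun _ _ h => h.elim⟩
      · exact fun _ _ _ h => h.elim
    exact fun p q r hp hq hr => this p hp q hq r hr
  · have : ∀ p : Concat M N, AtE p → ∀ q, AtE q → LtE p q ∨ p = q ∨ LtE q p := by
      simp only [hall, e1, e2, e3, e4]
      refine ⟨fun x hx => ⟨fun x' hx' => ?_, fun y hy => Or.inl ⟨hM.ne_bot hx, hN.ne_bot hy⟩⟩,
        fun y hy => ⟨fun x hx => Or.inr (Or.inr ⟨hM.ne_bot hx, hN.ne_bot hy⟩), fun y' hy' => ?_⟩⟩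
      · exact (hM.lt_total x x' hx hx').imp_right (Or.imp_left fun h => by rw [h])
      · exact (hN.lt_total y y' hy hy').imp_right (Or.imp_left fun h => by rw [h])
    exact fun p q hp hq => this p hp q hq
  · intro p q
    constructor
    · rw [ltE_concat]
      rintro (⟨h1, h2⟩ | h1 | h1)
      · obtain ⟨x, hx, hx'⟩ := hM.exists_at h1
        obtain ⟨y, hy, hy'⟩ := hN.exists_at h2
        exact ⟨_, _, hl hx, hr hy, e5.2 hx', e6.2 hy', e3.2 ⟨hM.ne_bot hx, hN.ne_bot hy⟩⟩
      · obtain ⟨x, y, hx, hy, hx', hy', h⟩ := (hM.lt_iff _ _).1 h1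
        exact ⟨_, _, hl hx, hl hy, e5.2 hx', e5.2 hy', e1.2 h⟩
      · obtain ⟨x, y, hx, hy, hx', hy', h⟩ := (hN.lt_iff _ _).1 h1
        exact ⟨_, _, hr hx, hr hy, e6.2 hx', e6.2 hy', e2.2 h⟩
    · have : ∀ p' : Concat M N, AtE p' → ∀ q', AtE q' → SubE p' p → SubE q' q → LtE p' q' →
          LtE p q := by
        simp only [hall, e1, e2, e3, e4, e5, e6]
        refine ⟨fun x hx => ⟨fun x' hx' h1 h2 h => ?_, fun y hy h1 h2 h => ?_⟩,
          fun y hy => ⟨fun _ _ _ _ h => h.elim, fun y' hy' h1 h2 h => ?_⟩⟩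
        · exact ltE_concat.2 (Or.inr (Or.inl ((hM.lt_iff _ _).2 ⟨_, _, hx, hx', h1, h2, h⟩)))
        · exact ltE_concat.2 (Or.inl ⟨fun h0 => hM.at_sub_bot hx (h0 ▸ h1),
            fun h0 => hN.at_sub_bot hy (h0 ▸ h2)⟩)
        · exact ltE_concat.2 (Or.inr (Or.inr ((hN.lt_iff _ _).2 ⟨_, _, hy, hy', h1, h2, h⟩)))
      rintro ⟨p', q', hp, hq, h1, h2, h⟩
      exact this p' hp q' hq h1 h2 h
  · by_cases ha1 : a.fst = botE M
    · have ha2 : a.snd ≠ botE N := fun h => ha (Concat.ext ha1 h)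
      obtain ⟨y, hy, hy', h⟩ := hN.least _ ha2
      refine ⟨_, hr hy, e6.2 hy', ?_⟩
      simp only [hall, e2, e5, e6, ha1]
      exact ⟨fun x hx hx' => absurd hx' (hM.at_sub_bot hx),
        fun z hz hz' => (h z hz hz').imp_left fun h => by rw [h]⟩
    · obtain ⟨x, hx, hx', h⟩ := hM.least _ ha1
      refine ⟨_, hl hx, e5.2 hx', ?_⟩
      simp only [hall, e1, e3, e5]
      exact ⟨fun z hz hz' => (h z hz hz').imp_left fun h => by rw [h],
        fun y hy _ => Or.inr ⟨hM.ne_bot hx, hN.ne_bot hy⟩⟩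
  · by_cases ha2 : a.snd = botE N
    · have ha1 : a.fst ≠ botE M := fun h => ha (Concat.ext h ha2)
      obtain ⟨y, hy, hy', h⟩ := hM.greatest _ ha1
      refine ⟨_, hl hy, e5.2 hy', ?_⟩
      simp only [hall, e1, e5, e6, ha2]
      exact ⟨fun z hz hz' => (h z hz hz').imp_left fun h => by rw [h],
        fun x hx hx' => absurd hx' (hN.at_sub_bot hx)⟩
    · obtain ⟨x, hx, hx', h⟩ := hN.greatest _ ha2
      refine ⟨_, hr hx, e6.2 hx', ?_⟩
      simp only [hall, e2, e3, e6]
      exact ⟨fun y hy _ => Or.inr ⟨hM.ne_bot hy, hN.ne_bot hx⟩,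
        fun z hz hz' => (h z hz hz').imp_left fun h => by rw [h]⟩

theorem forall_at_powS {n : ℕ} {P : PowS n → Prop} :
    (∀ p, AtE p → P p) ↔ ∀ i, P ⟨{i}⟩ := by
  constructor
  · exact fun h i => h _ ⟨i, rfl⟩
  · rintro h p ⟨i, hi⟩
    exact (PowS.ext hi.symm : (⟨{i}⟩ : PowS n) = p) ▸ h i

theorem exists_at_powS {n : ℕ} {P : PowS n → Prop} :
    (∃ p, AtE p ∧ P p) ↔ ∃ i, P ⟨{i}⟩ := by
  rw [← not_iff_not]
  push Not
  exact forall_at_powS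

theorem good_powS (n : ℕ) : Good (PowS n) := by
  have e1 {i j : Fin n} : LtE (⟨{i}⟩ : PowS n) ⟨{j}⟩ ↔ i < j := by simp [ltE_powS]
  have e2 {i : Fin n} {a : PowS n} : SubE ⟨{i}⟩ a ↔ i ∈ a.set := by simp [subE_powS]
  refine ⟨pre_powS n, fun a b c => Set.Subset.trans, fun a b => ?_, ?_, ?_, ?_, fun a b => ?_,
    fun k η b => ?_, fun a ha => ?_, fun a ha => ?_⟩
  · simp only [forall_at_powS, e2]
    exact fun h i hi => h i hi
  · simp [forall_at_powS, e1]
  · have : ∀ p : PowS n, AtE p → ∀ q, AtE q → ∀ r, AtE r → LtE p q → LtE q r → LtE p r := by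
      simp only [forall_at_powS, e1]
      exact fun i j k => lt_trans
    exact fun p q r hp hq hr => this p hp q hq r hr
  · have : ∀ p : PowS n, AtE p → ∀ q, AtE q → LtE p q ∨ p = q ∨ LtE q p := by
      simp only [forall_at_powS, e1, PowS.ext_iff, Set.singleton_eq_singleton_iff]
      exact fun i j => lt_trichotomy i j
    exact fun p q hp hq => this p hp q hq
  · rw [ltE_powS]
    constructor
    · rintro ⟨i, hi, j, hj, h⟩
      exact ⟨_, _, ⟨i, rfl⟩, ⟨j, rfl⟩, e2.2 hi, e2.2 hj, e1.2 h⟩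
    · rintro ⟨⟨_⟩, ⟨_⟩, ⟨i, rfl⟩, ⟨j, rfl⟩, hi, hj, h⟩
      exact ⟨i, e2.1 hi, j, e2.1 hj, e1.1 h⟩
  · refine ⟨⟨{i | η.Realize (Fin.cons ⟨{i}⟩ b : Fin (k + 1) → PowS n)}⟩, ?_⟩
    simp only [forall_at_powS, e2]
    exact fun i => Iff.rfl
  all_goals
    have h1 : a.set.Nonempty := Set.nonempty_iff_ne_empty.2 fun h => ha (PowS.ext h)
    simp only [exists_at_powS, forall_at_powS, e1, e2, PowS.ext_iff,
      Set.singleton_eq_singleton_iff]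
  · obtain ⟨i, hi⟩ := (Set.toFinite a.set).exists_minimal h1
    exact ⟨i, hi.prop, fun j hj => ((not_lt.1 (hi.not_lt hj)).eq_or_lt).imp_left Eq.symm⟩
  · obtain ⟨i, hi⟩ := (Set.toFinite a.set).exists_maximal h1
    exact ⟨i, hi.prop, fun j hj => (not_lt.1 (hi.not_gt hj)).eq_or_lt⟩

end Concat

/-! ### Initial segments -/

section InitSeg

variable {M : Type u₁} [lang.Structure M]

/-- The substructure of the elements that contain no atom after `x`. -/
def Good.initSeg (h : Good M) (x : M) : lang.Substructure M where
  carrier := {y | ¬ LtE x y}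
  fun_mem {n} f := by
    induction n, f using functions_cases with
    | bot => exact fun y _ => (funMap_eq_botE botS y) ▸ h.not_lt_bot x

variable (h : Good M) {x : M}

include h

theorem Good.mem_initSeg {y : M} : y ∈ h.initSeg x ↔ ¬ LtE x y := Iff.rfl

theorem Good.mem_initSeg_iff (hx : AtE x) {y : M} :
    y ∈ h.initSeg x ↔ ∀ z, AtE z → SubE z y → z = x ∨ LtE z x := by
  rw [h.mem_initSeg, h.lt_iff]
  constructor
  · intro h1 z hz hzy
    rcases h.lt_total z x hz hx with h2 | h2 | h2
    · exact Or.inr h2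
    · exact Or.inl h2
    · exact absurd ⟨x, z, hx, hz, h.refl x, hzy, h2⟩ h1
  · rintro h1 ⟨x', z, hx', hz, hx'x, hzy, h2⟩
    rw [h.at_sub_at hx' hx] at hx'x
    subst hx'x
    rcases h1 z hz hzy with rfl | h3
    · exact h.lt_irrefl _ hz h2
    · exact h.lt_asymm hx hz h2 h3

theorem Good.initSeg_down {y z : M} (hy : y ∈ h.initSeg x) (hzy : SubE z y) :
    z ∈ h.initSeg x := by
  rw [h.mem_initSeg, h.lt_iff] at *
  rintro ⟨a, b, ha, hb, h1, h2, h3⟩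
  exact hy ⟨a, b, ha, hb, h1, h.trans _ _ _ h2 hzy, h3⟩

theorem relMap_initSeg {n : ℕ} (R : lang.Relations n) (xs : Fin n → h.initSeg x) :
    Structure.RelMap R xs ↔ Structure.RelMap R fun i => (xs i : M) := Iff.rfl

theorem subE_initSeg {a b : h.initSeg x} : SubE a b ↔ SubE (a : M) b :=
  (relMap_initSeg h subS _).trans (relMap_sub _)

theorem ltE_initSeg {a b : h.initSeg x} : LtE a b ↔ LtE (a : M) b :=
  (relMap_initSeg h ltS _).trans (relMap_lt _)

theorem atE_initSeg {a : h.initSeg x} : AtE a ↔ AtE (a : M) :=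
  (relMap_initSeg h atmS _).trans (relMap_atm _)

theorem botE_initSeg : ((botE (h.initSeg x) : h.initSeg x) : M) = botE M :=
  (congrArg Subtype.val (funMap_eq_botE botS default).symm : _).trans (funMap_eq_botE botS _)

/-- The segment is closed downwards under `⊆`, so minimality among the non-bottom elements means the
same in it and in `M`. -/
theorem Good.pre_initSeg (x : M) : Pre (h.initSeg x) where
  refl a := (subE_initSeg h).2 (h.refl _)
  antisymm a b h1 h2 := Subtype.ext (h.antisymm _ _ ((subE_initSeg h).1 h1)
    ((subE_initSeg h).1 h2))
  bot_sub a := by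
    rw [subE_initSeg, botE_initSeg]
    exact h.bot_sub _
  at_iff a := by
    simp only [atE_initSeg, h.at_iff, Subtype.ext_iff, botE_initSeg, subE_initSeg, Ne,
      Subtype.forall]
    exact and_congr_right fun _ => ⟨fun h1 b _ => h1 b,
      fun h1 b hb => h1 b (h.initSeg_down a.2 hb) hb⟩

/-- Relativization of a formula to an initial segment, given by the free variable. -/
def relativize : {n : ℕ} → lang.BoundedFormula Empty n → lang.BoundedFormula (Fin 1) n
  | _, .falsum => .falsum
  | _, .equal s t =>
    .equal (s.relabel (Sum.map Empty.elim id)) (t.relabel (Sum.map Empty.elim id))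
  | _, .rel R ts => .rel R fun i => (ts i).relabel (Sum.map Empty.elim id)
  | _, .imp φ ψ => (relativize φ).imp (relativize ψ)
  | n, .all φ => .all
    (∼(ltS.boundedFormula₂ (Term.var (Sum.inl 0)) (Term.var (Sum.inr (Fin.last n)))) ⟹
      relativize φ)

theorem realize_term_relativize {n : ℕ} (t : lang.Term (Empty ⊕ Fin n)) (e : Empty → h.initSeg x)
    (w : Fin 1 → M) (xs : Fin n → h.initSeg x) :
    (t.relabel (Sum.map Empty.elim id)).realize (Sum.elim w fun i => (xs i : M)) =
      ((t.realize (Sum.elim e xs) : h.initSeg x) : M) := by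
  rw [Term.realize_relabel]
  refine Eq.trans ?_ (HomClass.realize_term (h.initSeg x).subtype (t := t))
  congr 1
  ext i
  rcases i with i | i
  · exact i.elim
  · rfl

theorem realize_relativize {n : ℕ} (φ : lang.BoundedFormula Empty n) (e : Empty → h.initSeg x)
    (w : Fin 1 → M) (hw : w 0 = x) (xs : Fin n → h.initSeg x) :
    (relativize φ).Realize w (fun i => (xs i : M)) ↔ φ.Realize e xs := by
  induction φ with
  | falsum => exact Iff.rfl
  | equal s t =>
    simp only [relativize, BoundedFormula.Realize, realize_term_relativize h _ e]
    exact Subtype.ext_iff.symm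
  | rel R ts =>
    simp only [relativize, BoundedFormula.Realize, realize_term_relativize h _ e]
    exact (relMap_initSeg h R _).symm
  | imp φ ψ ih₁ ih₂ =>
    rw [relativize, BoundedFormula.realize_imp, BoundedFormula.realize_imp, ih₁, ih₂]
  | @all n φ ih =>
    rw [relativize, BoundedFormula.realize_all, BoundedFormula.realize_all]
    have hs : ∀ a : h.initSeg x, (fun i => ((Fin.snoc (α := fun _ => h.initSeg x) xs a i :
        h.initSeg x) : M)) = Fin.snoc (α := fun _ => M) (fun i => (xs i : M)) (a : M) := fun a => by
      ext i; refine Fin.lastCases ?_ (fun j => ?_) i <;> simp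
    simp only [← ih, hs, Subtype.forall]
    refine forall_congr' fun a => ?_
    rw [BoundedFormula.realize_imp, BoundedFormula.realize_not, BoundedFormula.realize_rel₂,
      h.mem_initSeg]
    simp only [Term.realize_var, Sum.elim_inl, Sum.elim_inr, Fin.snoc_last, hw]
    rfl

/-- Relativization makes truth of `σ` in the segment up to `x` a first-order condition on `x`, to
which comprehension applies. This opens the way to induction on `x`. -/
theorem Good.exists_initSeg (σ : lang.Sentence) :
    ∃ X, ∀ x, AtE x → (SubE x X ↔ h.initSeg x ⊨ σ) := by
  obtain ⟨X, hX⟩ := h.comp 0 (relativize σ) default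
  refine ⟨X, fun x hx => (hX x hx).trans ?_⟩
  have := realize_relativize h (x := x) σ default (Fin.cons x default : Fin 1 → M) rfl default
  rw [Sentence.Realize, Formula.Realize, Formula.Realize, ← this]
  have h1 : (default : Fin 0 → M) = fun i => ((default : Fin 0 → h.initSeg x) i : M) :=
    Subsingleton.elim _ _
  rw [← h1]

theorem Good.elemEq_initSeg_first (hx : AtE x) (hx' : ∀ y, AtE y → ¬ LtE y x) :
    ElemEq (h.initSeg x) (PowS 1) := by
  have key : ∀ (a : h.initSeg x) (z : M), AtE z → SubE z a → z = x := fun a z hz hza =>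
    ((h.mem_initSeg_iff hx).1 a.2 z hz hza).resolve_right (hx' z hz)
  refine elemEq_of_surjective (h.pre_initSeg x) (pre_powS 1)
    (fun a => ⟨{i | SubE x a}⟩) (fun a b => ?_) (fun a b => ?_) ?_
  · rw [subE_powS, subE_initSeg]
    constructor
    · refine fun h1 => h.sep _ _ fun z hz hza => ?_
      obtain rfl := key a z hz hza
      exact h1 (show (0 : Fin 1) ∈ {i : Fin 1 | SubE z (a : M)} from hza)
    · exact fun h1 i hi => h.trans _ _ _ hi h1
  · rw [ltE_powS, ltE_initSeg, h.lt_iff]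
    constructor
    · rintro ⟨i, -, j, -, hij⟩
      exact absurd hij (by rw [Subsingleton.elim i j]; exact _root_.lt_irrefl j)
    · rintro ⟨z, z', hz, hz', h1, h2, h3⟩
      obtain rfl := key a z hz h1
      obtain rfl := key b z' hz' h2
      exact absurd h3 (h.lt_irrefl _ hz)
  · rintro ⟨s⟩
    by_cases hs : (0 : Fin 1) ∈ s
    · refine ⟨⟨x, h.mem_initSeg.2 (h.lt_irrefl x hx)⟩, PowS.ext (Set.ext fun i => ?_)⟩
      rw [Subsingleton.elim i 0]
      exact iff_of_true (h.refl x) hs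
    · refine ⟨⟨botE M, h.mem_initSeg.2 (h.not_lt_bot x)⟩, PowS.ext (Set.ext fun i => ?_)⟩
      rw [Subsingleton.elim i 0]
      exact iff_of_false (h.at_sub_bot hx) hs

theorem Good.exists_erase (hx : AtE x) (a : M) :
    ∃ b, ∀ z, AtE z → (SubE z b ↔ SubE z a ∧ z ≠ x) := by
  obtain ⟨c, hc⟩ := h.exists_compl x
  obtain ⟨b, hb⟩ := h.exists_inter a c
  exact ⟨b, fun z hz => by rw [hb z hz, hc z hz, h.at_sub_at hz hx]⟩

/-- Induction step along the atoms: with `w` the predecessor of `x`, an element of the segment up to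
`x` consists of an element of the segment up to `w` and the information whether `x` belongs to it.
-/
theorem Good.elemEq_initSeg_succ (hx : AtE x) {w : M} (hw : AtE w) (hwx : LtE w x)
    (hw' : ∀ y, AtE y → LtE y x → y = w ∨ LtE y w) :
    ElemEq (h.initSeg x) (Concat (h.initSeg w) (PowS 1)) := by
  -- `d a` is `a` with the atom `x` removed.
  choose d hd using fun a => h.exists_erase hx a
  have hmem : ∀ a ∈ h.initSeg x, d a ∈ h.initSeg w := fun a ha => by
    rw [h.mem_initSeg_iff hx] at ha
    rw [h.mem_initSeg_iff hw]
    intro z hz hza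
    obtain ⟨h1, h2⟩ := (hd a z hz).1 hza
    exact hw' z hz ((ha z hz h1).resolve_left h2)
  refine elemEq_of_surjective (h.pre_initSeg x) ((h.pre_initSeg w).concat (pre_powS 1))
    (fun a => .mk ⟨d a, hmem a a.2⟩ ⟨{i | SubE x a}⟩) (fun a b => ?_) (fun a b => ?_) ?_
  · rw [subE_concat, subE_powS, subE_initSeg, subE_initSeg]
    simp only [Concat.fst_mk, Concat.snd_mk]
    constructor
    · rintro ⟨h1, h2⟩
      refine h.sep _ _ fun z hz hza => ?_
      by_cases hzx : z = x
      · subst hzx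
        exact h2 (show (0 : Fin 1) ∈ {i : Fin 1 | SubE z (a : M)} from hza)
      · exact ((hd b z hz).1 (h.trans _ _ _ ((hd a z hz).2 ⟨hza, hzx⟩) h1)).1
    · refine fun h1 => ⟨h.sep _ _ fun z hz hza => ?_, fun i hi => h.trans _ _ _ hi h1⟩
      obtain ⟨h2, h3⟩ := (hd a z hz).1 hza
      exact (hd b z hz).2 ⟨h.trans _ _ _ h2 h1, h3⟩
  · rw [ltE_concat, ltE_powS, ltE_initSeg, ltE_initSeg]
    simp only [Concat.fst_mk, Concat.snd_mk, Ne, Subtype.ext_iff, botE_initSeg]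
    constructor
    · rintro (⟨h1, h2⟩ | h1 | ⟨i, -, j, -, hij⟩)
      · obtain ⟨z, hz, hza⟩ := h.exists_at h1
        obtain ⟨h3, h4⟩ := (hd a z hz).1 hza
        have hxb : SubE x (b : M) := by
          by_contra hxb
          exact h2 (PowS.ext (Set.eq_empty_of_forall_notMem fun i hi => hxb hi))
        exact (h.lt_iff _ _).2 ⟨z, x, hz, hx, h3, hxb,
          ((h.mem_initSeg_iff hx).1 a.2 z hz h3).resolve_left h4⟩
      · obtain ⟨z, z', hz, hz', h2, h3, h4⟩ := (h.lt_iff _ _).1 h1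
        exact (h.lt_iff _ _).2 ⟨z, z', hz, hz', ((hd a z hz).1 h2).1, ((hd b z' hz').1 h3).1, h4⟩
      · exact absurd hij (by rw [Subsingleton.elim i j]; exact _root_.lt_irrefl j)
    · intro h1
      obtain ⟨z, z', hz, hz', h2, h3, h4⟩ := (h.lt_iff _ _).1 h1
      have hzx : z ≠ x := by
        rintro rfl
        rcases (h.mem_initSeg_iff hx).1 b.2 z' hz' h3 with rfl | h5
        · exact h.lt_irrefl _ hz h4
        · exact h.lt_asymm hz hz' h4 h5
      have hza := (hd a z hz).2 ⟨h2, hzx⟩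
      by_cases hzx' : z' = x
      · subst hzx'
        refine Or.inl ⟨fun h0 => h.at_sub_bot hz (h0 ▸ hza), fun h0 => ?_⟩
        exact Set.notMem_empty (0 : Fin 1) ((Set.ext_iff.1 (congrArg PowS.set h0) 0).1 h3)
      · exact Or.inr (Or.inl ((h.lt_iff _ _).2 ⟨z, z', hz, hz', hza, (hd b z' hz').2 ⟨h3, hzx'⟩,
          h4⟩))
  · intro p
    have hp : ∀ z, AtE z → SubE z (p.fst : M) → LtE z x := fun z hz hzp => by
      rcases (h.mem_initSeg_iff hw).1 p.fst.2 z hz hzp with rfl | h1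
      · exact hwx
      · exact h.lt_trans _ _ _ hz hw hx h1 hwx
    have hxp : ¬ SubE x (p.fst : M) := fun h1 => h.lt_irrefl x hx (hp x hx h1)
    obtain ⟨u, hu⟩ := h.exists_union (p.fst : M) x
    by_cases hs : (0 : Fin 1) ∈ p.snd.set
    · refine ⟨⟨u, (h.mem_initSeg_iff hx).2 fun z hz hzu => ?_⟩,
        Concat.ext (Subtype.ext (h.ext fun z hz => ?_)) (PowS.ext (Set.ext fun i => ?_))⟩
      · exact ((hu z hz).1 hzu).symm.imp (h.eq_of_at hz hx) (hp z hz)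
      · simp only [Concat.fst_mk]
        rw [hd u z hz, hu z hz, h.at_sub_at hz hx]
        exact ⟨fun h1 => h1.1.resolve_right h1.2,
          fun h1 => ⟨Or.inl h1, fun h2 => hxp (h2 ▸ h1)⟩⟩
      · rw [Subsingleton.elim i 0]
        exact iff_of_true ((hu x hx).2 (Or.inr (h.refl x))) hs
    · refine ⟨⟨p.fst, (h.mem_initSeg_iff hx).2 fun z hz hzu => Or.inr (hp z hz hzu)⟩,
        Concat.ext (Subtype.ext (h.ext fun z hz => ?_)) (PowS.ext (Set.ext fun i => ?_))⟩
      · simp only [Concat.fst_mk]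
        rw [hd _ z hz]
        exact ⟨fun h1 => h1.1, fun h1 => ⟨h1, fun h2 => hxp (h2 ▸ h1)⟩⟩
      · rw [Subsingleton.elim i 0]
        exact iff_of_false hxp hs

theorem Good.elemEq_initSeg_last (hx : AtE x) (hx' : ∀ y, AtE y → y = x ∨ LtE y x) :
    ElemEq (h.initSeg x) M :=
  elemEq_of_surjective (h.pre_initSeg x) h.toPre Subtype.val (fun _ _ => (subE_initSeg h).symm)
    (fun _ _ => (ltE_initSeg h).symm)
    fun y => ⟨⟨y, (h.mem_initSeg_iff hx).2 fun z hz _ => hx' z hz⟩, rfl⟩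

theorem Good.elemEq_powS_zero (h0 : ∀ x : M, ¬ AtE x) : ElemEq M (PowS 0) := by
  refine elemEq_of_surjective h.toPre (pre_powS 0) (fun _ => ⟨∅⟩) (fun a b => ?_) (fun a b => ?_) ?_
  · exact iff_of_true ((pre_powS 0).refl _) (h.sep _ _ fun x hx => absurd hx (h0 x))
  · refine iff_of_false ?_ ?_
    · rintro ⟨i, -⟩
      exact i.elim0
    · rw [h.lt_iff]
      rintro ⟨x, -, hx, -⟩
      exact h0 x hx
  · exact fun p => ⟨botE M, PowS.ext (Set.ext fun i => i.elim0)⟩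

end InitSeg

/-! ### Every model is pseudofinite -/

/-- There are only finitely many patterns of truth values on `L`, so an arbitrary property `Q` of
patterns is a Boolean combination of members of `L`, built by branching on one sentence at a time.
-/
theorem exists_sentence_of_list (L : List lang.Sentence) (Q : Set lang.Sentence → Prop) :
    ∃ σ : lang.Sentence, ∀ (K : Type u₁) [lang.Structure K],
      K ⊨ σ ↔ Q {ψ | ψ ∈ L ∧ K ⊨ ψ} := by
  induction L generalizing Q with
  | nil =>
    by_cases h : Q ∅
    · exact ⟨⊤, fun K _ => by simp [h]⟩
    · exact ⟨⊥, fun K _ => by simp [h, Sentence.Realize]⟩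
  | cons ψ L ih =>
    obtain ⟨σ, hσ⟩ := ih fun s => Q (insert ψ s)
    obtain ⟨τ, hτ⟩ := ih Q
    refine ⟨(ψ ⊓ σ) ⊔ (∼ψ ⊓ τ), fun K _ => ?_⟩
    rw [Sentence.realize_sup, Sentence.realize_inf, Sentence.realize_inf, Sentence.realize_not,
      hσ, hτ]
    by_cases h : K ⊨ ψ
    · have : {χ | χ ∈ ψ :: L ∧ K ⊨ χ} = insert ψ {χ | χ ∈ L ∧ K ⊨ χ} := by
        ext χ
        simp only [List.mem_cons, Set.mem_ofPred_eq, Set.mem_insert_iff]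
        constructor
        · rintro ⟨rfl | h1, h2⟩
          · exact Or.inl rfl
          · exact Or.inr ⟨h1, h2⟩
        · rintro (rfl | h1)
          · exact ⟨Or.inl rfl, h⟩
          · exact ⟨Or.inr h1.1, h1.2⟩
      rw [this]
      simp [h]
    · have : {χ | χ ∈ ψ :: L ∧ K ⊨ χ} = {χ | χ ∈ L ∧ K ⊨ χ} := by
        ext χ
        simp only [List.mem_cons, Set.mem_ofPred_eq]
        constructor
        · rintro ⟨rfl | h1, h2⟩
          · exact absurd h2 h
          · exact ⟨h1, h2⟩
        · exact fun h1 => ⟨Or.inr h1.1, h1.2⟩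
      rw [this]
      simp [h]

/-- `K` and the finite order with `n` elements cannot be distinguished by `φ` after concatenation
with a finite order. -/
def Similar (φ : lang.Sentence) (K : Type u₁) [lang.Structure K] (n : ℕ) : Prop :=
  ∀ r, Concat K (PowS r) ⊨ φ ↔ PowS (n + r) ⊨ φ

/-- By the composition theorem `K` enters `Similar φ K n` only through the truth values of the first
sides of `rects φ`. The quantifiers over `n` and `r` thus become part of a property of a finite
pattern and need not be expressed in the language. -/
theorem exists_sentence_similar (φ : lang.Sentence) :
    ∃ σ : lang.Sentence, ∀ (K : Type u₁) [lang.Structure K], Pre K →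
      (K ⊨ σ ↔ ∃ n, Similar φ K n) := by
  obtain ⟨σ, hσ⟩ := exists_sentence_of_list.{u₁} ((rects φ).map Prod.fst) fun s =>
    ∃ n, ∀ r, (∃ p ∈ rects φ, p.1 ∈ s ∧ PowS r ⊨ p.2) ↔ PowS (n + r) ⊨ φ
  refine ⟨σ, fun K _ hK => (hσ K).trans (exists_congr fun n => forall_congr' fun r => ?_)⟩
  rw [realize_sentence_concat hK (pre_powS r)]
  refine iff_congr (exists_congr fun p => and_congr_right fun hp => and_congr_left fun _ => ?_)
    Iff.rfl
  exact and_iff_right (List.mem_map_of_mem hp)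

theorem Similar.congr {φ : lang.Sentence} {K : Type u₁} {K' : Type u₂} [lang.Structure K]
    [lang.Structure K'] (hK : Pre K) (hK' : Pre K') (h : ElemEq K K') {n : ℕ}
    (hs : Similar φ K n) : Similar φ K' n := fun r =>
  (h.symm.concat hK' (pre_powS r) hK (pre_powS r) (fun _ => Iff.rfl) φ).trans (hs r)

theorem similar_powS (φ : lang.Sentence) (n : ℕ) : Similar φ (PowS n) n :=
  fun r => (elemEq_powS_add n r φ).symm

/-- Here it matters that `Similar` quantifies over all right factors: the new atom is absorbed into
the factor, which becomes `1 + r`. -/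
theorem Similar.succ {φ : lang.Sentence} {K : Type u₁} [lang.Structure K] (hK : Pre K) {n : ℕ}
    (hs : Similar φ K n) : Similar φ (Concat K (PowS 1)) (n + 1) := fun r => by
  rw [elemEq_concat_assoc hK (pre_powS 1) (pre_powS r),
    ElemEq.concat hK ((pre_powS 1).concat (pre_powS r)) hK (pre_powS (1 + r)) (fun _ => Iff.rfl)
      (elemEq_powS_add 1 r).symm, hs, Nat.add_assoc]

section Pseudofinite

variable {M : Type u₁} [lang.Structure M]

/-- Least counterexample. The atoms whose segment is similar to no finite order form an element `X`
of `M`. Its least atom is not the first atom of `M`, so it has a predecessor, whose segment is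
similar to some `n`; then `n + 1` serves for the least atom. -/
theorem Good.similar_initSeg (h : Good M) (φ : lang.Sentence) (x : M) (hx : AtE x) :
    ∃ n, Similar φ (h.initSeg x) n := by
  obtain ⟨σ, hσ⟩ := exists_sentence_similar.{u₁} φ
  obtain ⟨X, hX⟩ := h.exists_initSeg (∼σ)
  simp only [Sentence.realize_not, hσ _ (h.pre_initSeg _)] at hX
  by_contra hn
  obtain ⟨y, hy, hyX, hy'⟩ := h.least X fun h0 => h.at_sub_bot hx (h0 ▸ (hX x hx).2 hn)
  refine (hX y hy).1 hyX ?_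
  by_cases hf : ∀ z, AtE z → ¬ LtE z y
  · exact ⟨1, (similar_powS φ 1).congr (pre_powS 1) (h.pre_initSeg y)
      (h.elemEq_initSeg_first hy hf).symm⟩
  push Not at hf
  obtain ⟨z, hz, hzy⟩ := hf
  obtain ⟨Y, hY⟩ := h.exists_lt y
  -- The predecessor of `y` is the greatest element of the set of atoms before `y`.
  obtain ⟨w, hw, hwY, hw'⟩ := h.greatest Y fun h0 => h.at_sub_bot hz (h0 ▸ (hY z hz).2 hzy)
  have hwy := (hY w hw).1 hwY
  have hwX : ¬ SubE w X := fun h1 => by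
    rcases hy' w hw h1 with rfl | h2
    · exact h.lt_irrefl _ hw hwy
    · exact h.lt_asymm hw hy hwy h2
  rw [hX w hw, not_not] at hwX
  obtain ⟨n, hs⟩ := hwX
  exact ⟨n + 1, (hs.succ (h.pre_initSeg w)).congr ((h.pre_initSeg w).concat (pre_powS 1))
    (h.pre_initSeg y) (h.elemEq_initSeg_succ hy hw hwy
      fun u hu huy => hw' u hu ((hY u hu).2 huy)).symm⟩

theorem Good.exists_similar (h : Good M) (φ : lang.Sentence) : ∃ n, Similar φ M n := by
  by_cases h0 : ∀ x : M, ¬ AtE x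
  · exact ⟨0, (similar_powS φ 0).congr (pre_powS 0) h.toPre (h.elemEq_powS_zero h0).symm⟩
  push Not at h0
  obtain ⟨x, hx⟩ := h0
  obtain ⟨top, htop⟩ := h.exists_top
  obtain ⟨l, hl, -, hl'⟩ := h.greatest top fun h0 => h.at_sub_bot hx (h0 ▸ htop x)
  exact (h.similar_initSeg φ l hl).imp fun n hs => hs.congr (h.pre_initSeg l) h.toPre
    (h.elemEq_initSeg_last hl fun y hy => hl' y hy (htop y))

theorem elemEq_concat_powS_zero (h : Good M) : ElemEq (Concat M (PowS 0)) M := by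
  have e : ∀ p : PowS 0, p = ⟨∅⟩ := fun p => PowS.ext (Set.ext fun i => i.elim0)
  refine elemEq_of_surjective (h.toPre.concat (pre_powS 0)) h.toPre Concat.fst (fun a b => ?_)
    (fun a b => ?_) fun a => ⟨.mk a ⟨∅⟩, rfl⟩
  · rw [subE_concat, e a.snd, e b.snd]
    exact (and_iff_left ((pre_powS 0).refl _)).symm
  · rw [ltE_concat, e a.snd, e b.snd, botE_powS]
    simp [ltE_powS]

theorem Good.exists_powS (h : Good M) {φ : lang.Sentence} (hφ : M ⊨ φ) : ∃ n, PowS n ⊨ φ := by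
  obtain ⟨n, hn⟩ := h.exists_similar φ
  -- Similarity is used with the empty right factor, `r = 0`.
  exact ⟨n + 0, (hn 0).1 ((elemEq_concat_powS_zero h φ).2 hφ)⟩

end Pseudofinite

/-! ### Spectra of sentences -/

/-- The numbers `n` such that the finite model with `n` atoms satisfies `φ`. -/
def spec (φ : lang.Sentence) : Set ℕ := {n | PowS n ⊨ φ}

theorem mem_spec {φ : lang.Sentence} {n : ℕ} : n ∈ spec φ ↔ PowS n ⊨ φ := Iff.rfl

/-- Eventually periodic sets of natural numbers. -/
def EvPeriodic (L : Set ℕ) : Prop := ∃ t m, 0 < m ∧ ∀ n, t ≤ n → (n + m ∈ L ↔ n ∈ L)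

theorem mem_spec_add {φ : lang.Sentence} {n m : ℕ} :
    n + m ∈ spec φ ↔ ∃ p ∈ rects φ, PowS n ⊨ p.1 ∧ PowS m ⊨ p.2 := by
  rw [mem_spec, elemEq_powS_add n m, realize_sentence_concat (pre_powS n) (pre_powS m)]

/-- Myhill–Nerode by pigeonhole: two sizes `i < j` satisfy the same second sides of `rects φ`, so `n
+ i` and `n + j` are together in or out of the spectrum for every `n`. -/
theorem evPeriodic_spec (φ : lang.Sentence) : EvPeriodic (spec φ) := by
  have : Finite {p // p ∈ rects φ} := (rects φ).finite_toSet
  obtain ⟨i, j, hij, h⟩ := Finite.exists_ne_map_eq_of_infinite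
    fun i : ℕ => {p : {p // p ∈ rects φ} | PowS i ⊨ p.1.2}
  have key : ∀ n, n + i ∈ spec φ ↔ n + j ∈ spec φ := fun n => by
    simp only [mem_spec_add]
    refine exists_congr fun p => and_congr_right fun hp => and_congr_right fun _ => ?_
    exact Set.ext_iff.1 h ⟨p, hp⟩
  wlog hlt : i < j generalizing i j
  · exact this j i hij.symm h.symm (fun n => (key n).symm)
      (lt_of_le_of_ne (not_lt.1 hlt) hij.symm)
  refine ⟨i, j - i, Nat.sub_pos_of_lt hlt, fun n hn => ?_⟩
  have h1 := key (n - i)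
  rw [Nat.sub_add_cancel hn] at h1
  rw [h1]
  congr! 1
  omega

-- Definability of arithmetic progressions in finite models.

section Formulas

variable {n : ℕ}

/-- The `j`-th variable is the immediate successor of the `i`-th. -/
def succF (i j : Fin n) : lang.BoundedFormula Empty n :=
  ltF (v i) (v j) ⊓
    allAt (∼(ltF (v i.castSucc) (v (Fin.last n)) ⊓ ltF (v (Fin.last n)) (v j.castSucc)))

/-- The `j`-th variable is the `k`-th successor of the `i`-th. -/
def distF : ℕ → {n : ℕ} → Fin n → Fin n → lang.BoundedFormula Empty n
  | 0, _, i, j => v i =' v j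
  | k + 1, n, i, j => exAt (succF i.castSucc (Fin.last n) ⊓ distF k (Fin.last n) j.castSucc)

/-- The `i`-th variable is the `k`-th successor of the first atom. -/
def indexF (k : ℕ) (i : Fin n) : lang.BoundedFormula Empty n :=
  exAt (allAt (∼(ltF (v (Fin.last (n + 1))) (v (Fin.last n).castSucc))) ⊓
    distF k (Fin.last n) i.castSucc)

/-- The number of atoms is of the form `a + 1 + k * m`. -/
def progF (a m : ℕ) : lang.Sentence :=
  ∃' (allAt (subF (v 1) (v 0) ⇔ indexF a 1 ⊔ exAt (subF (v 2) (v 0) ⊓ distF m 2 1)) ⊓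
    exAt (subF (v 1) (v 0) ⊓ allAt (∼(ltF (v 1) (v 2)))))

variable {N : ℕ}

theorem singleton_lt_singleton {i j : Fin N} : LtE (⟨{i}⟩ : PowS N) ⟨{j}⟩ ↔ i < j := by
  simp [ltE_powS]

theorem singleton_sub {i : Fin N} {a : PowS N} : SubE ⟨{i}⟩ a ↔ i ∈ a.set := by simp [subE_powS]

theorem realize_succF {e : Empty → PowS N} {xs : Fin n → PowS N} {i j : Fin n} {a b : Fin N}
    (hi : xs i = ⟨{a}⟩) (hj : xs j = ⟨{b}⟩) :
    (succF i j).Realize e xs ↔ (a : ℕ) + 1 = b := by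
  simp only [succF, BoundedFormula.realize_inf, realize_ltF, realize_allAt,
    BoundedFormula.realize_not, realize_v, Fin.snoc_castSucc, Fin.snoc_last, forall_at_powS, hi, hj,
    singleton_lt_singleton]
  constructor
  · rintro ⟨h1, h2⟩
    by_contra h3
    have h4 : (a : ℕ) + 1 < b := lt_of_le_of_ne h1 h3
    exact h2 ⟨a + 1, h4.trans b.2⟩ ⟨Fin.lt_def.2 (Nat.lt_succ_self _), Fin.lt_def.2 h4⟩
  · intro h
    refine ⟨Fin.lt_def.2 (by omega), fun c hc => ?_⟩
    rw [Fin.lt_def, Fin.lt_def] at hc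
    omega

theorem realize_distF {e : Empty → PowS N} (k : ℕ) {n : ℕ} {xs : Fin n → PowS N} {i j : Fin n}
    {a b : Fin N} (hi : xs i = ⟨{a}⟩) (hj : xs j = ⟨{b}⟩) :
    (distF k i j).Realize e xs ↔ (a : ℕ) + k = b := by
  induction k generalizing n a with
  | zero =>
    simp only [distF, BoundedFormula.realize_bdEqual, realize_v, hi, hj, PowS.ext_iff,
      Set.singleton_eq_singleton_iff, Fin.ext_iff, add_zero]
  | succ k ih =>
    simp only [distF, realize_exAt, BoundedFormula.realize_inf, exists_at_powS]
    have h1 : ∀ c : Fin N, ((succF i.castSucc (Fin.last n)).Realize e (Fin.snoc xs ⟨{c}⟩) ∧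
        (distF k (Fin.last n) j.castSucc).Realize e (Fin.snoc xs ⟨{c}⟩)) ↔
        (a : ℕ) + 1 = c ∧ (c : ℕ) + k = b := fun c => by
      rw [realize_succF (a := a) (b := c) (by simpa using hi) (by simp),
        ih (a := c) (by simp) (by simpa using hj)]
    simp only [h1]
    constructor
    · rintro ⟨c, h2, h3⟩
      omega
    · intro h
      exact ⟨⟨a + 1, by omega⟩, rfl, by simp only; omega⟩

theorem realize_indexF {e : Empty → PowS N} (k : ℕ) {xs : Fin n → PowS N} {i : Fin n}
    {a : Fin N} (hi : xs i = ⟨{a}⟩) : (indexF k i).Realize e xs ↔ (a : ℕ) = k := by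
  simp only [indexF, realize_exAt, BoundedFormula.realize_inf, exists_at_powS, realize_allAt,
    BoundedFormula.realize_not, realize_ltF, realize_v, forall_at_powS, Fin.snoc_castSucc,
    Fin.snoc_last, singleton_lt_singleton]
  have h1 : ∀ c : Fin N, (distF k (Fin.last n) i.castSucc).Realize e (Fin.snoc xs ⟨{c}⟩) ↔
      (c : ℕ) + k = a := fun c => realize_distF k (by simp) (by simpa using hi)
  simp only [h1]
  constructor
  · rintro ⟨c, h2, h3⟩
    have := h2 ⟨0, c.pos⟩
    rw [Fin.lt_def] at this
    simp only at this
    omega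
  · rintro rfl
    refine ⟨⟨0, a.pos⟩, fun b hb => ?_, Nat.zero_add _⟩
    rw [Fin.lt_def] at hb
    exact Nat.not_lt_zero _ hb

/-- Positions count from `0`, so a last atom at position `a + k * m` means `a + 1 + k * m` atoms.
The clause on `X` is recursive; as `m > 0` the recursion is well founded and its only solution is
the set of positions `a + k * m`. -/
theorem spec_progF (a : ℕ) {m : ℕ} (hm : 0 < m) :
    spec (progF a m) = {n | ∃ k, n = a + 1 + k * m} := by
  ext N
  have h1 : N ∈ spec (progF a m) ↔ ∃ X : PowS N,
      (∀ i, i ∈ X.set ↔ (i : ℕ) = a ∨ ∃ j ∈ X.set, (j : ℕ) + m = i) ∧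
        ∃ i ∈ X.set, ∀ j, ¬ i < j := by
    rw [mem_spec, progF, Sentence.Realize, Formula.Realize, BoundedFormula.realize_ex]
    refine exists_congr fun X => ?_
    simp only [BoundedFormula.realize_inf, realize_allAt, realize_exAt, forall_at_powS,
      exists_at_powS, BoundedFormula.realize_iff, BoundedFormula.realize_sup, realize_subF,
      realize_ltF, realize_v, BoundedFormula.realize_not]
    refine and_congr (forall_congr' fun i => iff_congr ?_ (or_congr ?_ ?_)) ?_
    · exact singleton_sub
    · exact realize_indexF a rfl
    · exact exists_congr fun j => and_congr singleton_sub (realize_distF m rfl rfl)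
    · exact exists_congr fun i => and_congr singleton_sub
        (forall_congr' fun j => not_congr singleton_lt_singleton)
  rw [h1]
  constructor
  · rintro ⟨X, hX, i, hi, hlast⟩
    have h2 : ∀ (b : ℕ) (i : Fin N), (i : ℕ) = b → i ∈ X.set → ∃ k, b = a + k * m := by
      intro b
      induction b using Nat.strong_induction_on with
      | _ b ih =>
        intro i hib hi
        rcases (hX i).1 hi with h3 | ⟨j, hj, hji⟩
        · exact ⟨0, by omega⟩
        · obtain ⟨k, hk⟩ := ih j (by omega) j rfl hj
          exact ⟨k + 1, by rw [Nat.succ_mul]; omega⟩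
    obtain ⟨k, hk⟩ := h2 i i rfl hi
    refine ⟨k, ?_⟩
    by_contra h3
    exact hlast ⟨i + 1, by omega⟩ (Fin.lt_def.2 (Nat.lt_succ_self _))
  · rintro ⟨k, hk⟩
    refine ⟨⟨{i | ∃ k, (i : ℕ) = a + k * m}⟩, fun i => ⟨?_, ?_⟩, ⟨a + k * m, by omega⟩, ⟨k, rfl⟩,
      fun j => ?_⟩
    · rintro ⟨k, hk⟩
      rcases k with _ | k
      · exact Or.inl (by omega)
      · rw [Nat.succ_mul] at hk
        exact Or.inr ⟨⟨a + k * m, by omega⟩, ⟨k, rfl⟩, by simp only; omega⟩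
    · rintro (h2 | ⟨j, ⟨k, hk⟩, h2⟩)
      · exact ⟨0, by omega⟩
      · exact ⟨k + 1, by rw [Nat.succ_mul]; omega⟩
    · rw [Fin.lt_def]
      simp only
      omega

end Formulas

-- Every eventually periodic set is a spectrum.

theorem spec_not (φ : lang.Sentence) : spec (∼φ) = (spec φ)ᶜ := rfl

theorem spec_inf (φ ψ : lang.Sentence) : spec (φ ⊓ ψ) = spec φ ∩ spec ψ :=
  Set.ext fun _ => Sentence.realize_inf _

theorem spec_sup (φ ψ : lang.Sentence) : spec (φ ⊔ ψ) = spec φ ∪ spec ψ :=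
  Set.ext fun _ => Sentence.realize_sup _

theorem exists_spec_eq_biUnion {ι : Type*} (s : Finset ι) (f : ι → Set ℕ)
    (h : ∀ i ∈ s, ∃ φ, spec φ = f i) : ∃ φ, spec φ = ⋃ i ∈ s, f i := by
  classical
  induction s using Finset.induction_on with
  | empty => exact ⟨⊥, by ext; simp [mem_spec, Sentence.Realize]⟩
  | insert a s _ ih =>
    obtain ⟨φ, hφ⟩ := h a (Finset.mem_insert_self a s)
    obtain ⟨ψ, hψ⟩ := ih fun i hi => h i (Finset.mem_insert_of_mem hi)
    exact ⟨φ ⊔ ψ, by rw [spec_sup, hφ, hψ, Finset.set_biUnion_insert]⟩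

/-- `progF a 1` says that there are at least `a + 1` atoms; size `0` is the negation of the weakest
such sentence. -/
theorem exists_spec_eq_singleton (a : ℕ) : ∃ φ, spec φ = {a} := by
  rcases a with _ | a
  · refine ⟨∼(progF 0 1), ?_⟩
    rw [spec_not, spec_progF 0 one_pos]
    ext n
    simp only [Set.mem_compl_iff, Set.mem_ofPred_eq, Set.mem_singleton_iff, not_exists]
    constructor
    · intro h
      by_contra h0
      exact h (n - 1) (by omega)
    · rintro rfl k
      omega
  · refine ⟨progF a 1 ⊓ ∼(progF (a + 1) 1), ?_⟩
    rw [spec_inf, spec_not, spec_progF a one_pos, spec_progF (a + 1) one_pos]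
    ext n
    simp only [Set.mem_compl_iff, Set.mem_ofPred_eq, Set.mem_singleton_iff, not_exists,
      Set.mem_inter_iff]
    constructor
    · rintro ⟨⟨k, hk⟩, h⟩
      by_contra h0
      exact h (k - 1) (by omega)
    · rintro rfl
      exact ⟨⟨0, by omega⟩, fun k => by omega⟩

theorem EvPeriodic.exists_spec_eq {L : Set ℕ} (h : EvPeriodic L) : ∃ φ, spec φ = L := by
  classical
  obtain ⟨t, m, hm, h⟩ := h
  have hk : ∀ k n, t ≤ n → (n + k * m ∈ L ↔ n ∈ L) := fun k n hn => by
    induction k with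
    | zero => simp
    | succ k ih => rw [Nat.succ_mul, ← Nat.add_assoc, h _ (by omega), ih]
  -- `L` is a finite set below `t + 1` together with at most `m` progressions of difference `m`. The
  -- cut is at `t + 1` because the progressions of `spec_progF` start at a successor.
  obtain ⟨φ, hφ⟩ := exists_spec_eq_biUnion ((Finset.range (t + 1)).filter (· ∈ L)) (fun a => {a})
    fun a _ => exists_spec_eq_singleton a
  obtain ⟨ψ, hψ⟩ := exists_spec_eq_biUnion ((Finset.range m).filter (t + 1 + · ∈ L))
    (fun a => {n | ∃ k, n = t + a + 1 + k * m}) fun a _ => ⟨_, spec_progF (t + a) hm⟩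
  refine ⟨φ ⊔ ψ, ?_⟩
  rw [spec_sup, hφ, hψ]
  ext n
  simp only [Set.mem_union, Set.mem_iUnion, Finset.mem_filter, Finset.mem_range,
    Set.mem_singleton_iff, Set.mem_ofPred_eq, exists_prop]
  constructor
  · rintro (⟨a, ⟨-, ha⟩, rfl⟩ | ⟨a, ⟨-, ha⟩, k, rfl⟩)
    · exact ha
    · rw [hk k _ (by omega), show t + a + 1 = t + 1 + a by omega]
      exact ha
  · intro hn
    by_cases hnt : n < t + 1
    · exact Or.inl ⟨n, ⟨hnt, hn⟩, rfl⟩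
    · have h1 := Nat.mod_add_div (n - (t + 1)) m
      rw [Nat.mul_comm] at h1
      have h2 : n = t + 1 + (n - (t + 1)) % m + (n - (t + 1)) / m * m := by omega
      refine Or.inr ⟨(n - (t + 1)) % m, ⟨Nat.mod_lt _ hm, ?_⟩, (n - (t + 1)) / m, by omega⟩
      rw [h2, hk _ _ (by omega)] at hn
      exact hn

/-! ### Eventually periodic sets -/

theorem EvPeriodic.add_mul {L : Set ℕ} {t m : ℕ} (h : ∀ n, t ≤ n → (n + m ∈ L ↔ n ∈ L))
    {n : ℕ} (hn : t ≤ n) (k : ℕ) : n + m * k ∈ L ↔ n ∈ L := by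
  induction k with
  | zero => rfl
  | succ k ih => rw [Nat.mul_succ, ← Nat.add_assoc, h _ (by omega), ih]

theorem EvPeriodic.add {K L : Set ℕ} (hK : EvPeriodic K) (hL : EvPeriodic L) :
    EvPeriodic {n | ∃ i ∈ K, ∃ j ∈ L, i + j = n} := by
  obtain ⟨t, m, hm, hK⟩ := hK
  obtain ⟨t', m', hm', hL⟩ := hL
  have h1 : ∀ n, t ≤ n → (n + m * m' ∈ K ↔ n ∈ K) := fun n hn => EvPeriodic.add_mul hK hn m'
  have h2 : ∀ n, t' ≤ n → (n + m * m' ∈ L ↔ n ∈ L) := fun n hn => by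
    rw [Nat.mul_comm]
    exact EvPeriodic.add_mul hL hn m
  -- `m * m'` is a common period. Above this threshold one of the two summands is large enough to be
  -- shifted by it in either direction.
  refine ⟨t + t' + m * m', m * m', Nat.mul_pos hm hm', fun n hn => ⟨?_, ?_⟩⟩
  · rintro ⟨i, hi, j, hj, hij⟩
    rcases le_or_gt (t + m * m') i with h | h
    · exact ⟨i - m * m', (h1 _ (by omega)).1 (by rwa [Nat.sub_add_cancel (by omega)]), j, hj,
        by omega⟩
    · exact ⟨i, hi, j - m * m', (h2 _ (by omega)).1 (by rwa [Nat.sub_add_cancel (by omega)]),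
        by omega⟩
  · rintro ⟨i, hi, j, hj, hij⟩
    rcases le_or_gt t i with h | h
    · exact ⟨i + m * m', (h1 _ h).2 hi, j, hj, by omega⟩
    · exact ⟨i, hi, j + m * m', (h2 _ (by omega)).2 hj, by omega⟩

/-! ### Completions of the theory -/

section Completions

variable {T : lang.Theory} {M : Type u₁} [lang.Structure M]

theorem mem_iff_realize {p : lang.Theory} (hp : p.IsMaximal) (hM : M ⊨ p) (φ : lang.Sentence) :
    φ ∈ p ↔ M ⊨ φ := by
  refine ⟨fun h => hM.realize_of_mem φ h, fun h => ?_⟩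
  by_contra h'
  exact (Sentence.realize_not M).1
    (hM.realize_of_mem _ ((hp.mem_or_not_mem φ).resolve_left h')) h

/-- One inclusion suffices because both theories are complete and satisfiable. -/
theorem ZeroTypes.ext {p q : ZeroTypes T} (h : ∀ φ ∈ p.1, φ ∈ q.1) : p = q := by
  refine Subtype.ext (Set.Subset.antisymm h fun φ hφ => ?_)
  by_contra h'
  obtain ⟨M⟩ := q.2.2.1
  exact (Sentence.realize_not M).1 ((mem_iff_realize q.2.2 M.is_model _).1
    (h _ ((p.2.2.mem_or_not_mem φ).resolve_left h'))) ((mem_iff_realize q.2.2 M.is_model _).1 hφ)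

theorem ZeroTypes.good (p : ZeroTypes TMSOFin) (hM : M ⊨ p.1) : Good M :=
  good_of_model (hM.mono p.2.1)

theorem ZeroTypes.isOpen_mem (φ : lang.Sentence) : IsOpen {p : ZeroTypes T | φ ∈ p.1} :=
  TopologicalSpace.isOpen_generateFrom_of_mem ⟨φ, rfl⟩

instance : T2Space (ZeroTypes T) where
  t2 p q hpq := by
    obtain ⟨φ, hp, hq⟩ : ∃ φ ∈ p.1, φ ∉ q.1 := by
      by_contra h
      push Not at h
      exact hpq (ZeroTypes.ext h)
    refine ⟨_, _, ZeroTypes.isOpen_mem φ, ZeroTypes.isOpen_mem (∼φ), hp,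
      (q.2.2.mem_or_not_mem φ).resolve_left hq, Set.disjoint_left.2 fun r h1 h2 => ?_⟩
    obtain ⟨K⟩ := r.2.2.1
    exact (Sentence.realize_not K).1 ((mem_iff_realize r.2.2 K.is_model _).1 h2)
      ((mem_iff_realize r.2.2 K.is_model _).1 h1)

/-- The right-hand side mentions only the theories `p` and `q`, so the operation does not depend on
the chosen models. -/
theorem completeTheory_concat {N : Type u₂} [lang.Structure N] (p q : ZeroTypes TMSOFin)
    (hM : M ⊨ p.1) (hN : N ⊨ q.1) :
    lang.completeTheory (Concat M N) = {φ | ∃ r ∈ rects φ, r.1 ∈ p.1 ∧ r.2 ∈ q.1} := by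
  ext φ
  rw [mem_completeTheory, realize_sentence_concat (p.good hM).toPre (q.good hN).toPre]
  exact exists_congr fun r => and_congr_right fun _ =>
    and_congr (mem_iff_realize p.2.2 hM _).symm (mem_iff_realize q.2.2 hN _).symm

/-- The theory of the concatenation of a model of `p` and a model of `q`. -/
def concatTheory (p q : ZeroTypes TMSOFin) : ZeroTypes TMSOFin :=
  ⟨{φ | ∃ r ∈ rects φ, r.1 ∈ p.1 ∧ r.2 ∈ q.1}, by
    obtain ⟨M⟩ := p.2.2.1
    obtain ⟨N⟩ := q.2.2.1
    have : Nonempty (Concat M N) := ⟨botE _⟩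
    rw [← completeTheory_concat p q M.is_model N.is_model]
    exact ⟨Theory.model_iff_subset_completeTheory.1
      ((p.good M.is_model).concat (q.good N.is_model)).model, completeTheory.isMaximal _ _⟩⟩

end Completions

/-! ### The free profinite monoid on one generator -/

section FreeProfinite

/-- The powers of the generator. -/
def gen (n : ℕ) : FreeMonoid Unit := FreeMonoid.of () ^ n

theorem gen_add (n m : ℕ) : gen (n + m) = gen n * gen m := pow_add _ _ _

theorem gen_length (a : FreeMonoid Unit) : gen a.length = a := by
  induction a using FreeMonoid.inductionOn' with
  | one => rfl
  | of_mul u a ih =>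
    rw [FreeMonoid.length_mul, FreeMonoid.length_of, gen_add, ih]
    rfl

theorem length_gen (n : ℕ) : (gen n).length = n := by
  induction n with
  | zero => rfl
  | succ n ih => rw [gen_add, FreeMonoid.length_mul, ih]; rfl

/-- The class of the `n`-th power of the generator. -/
def cls (c : FinCon Unit) (n : ℕ) : c.1.Quotient := (gen n : c.1.Quotient)

theorem cls_add (c : FinCon Unit) (n m : ℕ) : cls c (n + m) = cls c n * cls c m := by
  rw [cls, gen_add]
  rfl

theorem cls_surjective (c : FinCon Unit) (q : c.1.Quotient) : ∃ n, cls c n = q := by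
  induction q using Con.induction_on with
  | H a => exact ⟨a.length, by rw [cls, gen_length]⟩

/-- Two exponents `i < j` fall into the same class; adding `n - i` to both shows that from `i` on
the classes have period `j - i`. -/
theorem evPeriodic_of_finCon (c : FinCon Unit) {L : Set ℕ}
    (hL : ∀ n m, cls c n = cls c m → (n ∈ L ↔ m ∈ L)) : EvPeriodic L := by
  have := c.2
  obtain ⟨i, j, hij, h⟩ := Finite.exists_ne_map_eq_of_infinite (cls c)
  wlog hlt : i < j generalizing i j
  · exact this j i hij.symm h.symm (lt_of_le_of_ne (not_lt.1 hlt) hij.symm)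
  refine ⟨i, j - i, Nat.sub_pos_of_lt hlt, fun n hn => hL _ _ ?_⟩
  rw [show n + (j - i) = n - i + j by omega, cls_add, ← h, ← cls_add, Nat.sub_add_cancel hn]

theorem evPeriodic_cls (c : FinCon Unit) (q : c.1.Quotient) : EvPeriodic {n | cls c n = q} :=
  evPeriodic_of_finCon c fun n m h => by simp only [Set.mem_ofPred_eq, h]

/-- The syntactic congruence of a set of natural numbers. -/
def syntacticCon (L : Set ℕ) : Con (FreeMonoid Unit) where
  r a b := ∀ k, a.length + k ∈ L ↔ b.length + k ∈ L
  iseqv := ⟨fun _ _ => Iff.rfl, fun h k => (h k).symm, fun h h' k => (h k).trans (h' k)⟩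
  mul' {a b c d} h h' k := by
    rw [FreeMonoid.length_mul, FreeMonoid.length_mul, Nat.add_assoc, h, Nat.add_left_comm, h',
      Nat.add_left_comm, Nat.add_assoc]

theorem syntacticCon_gen {L : Set ℕ} {n m : ℕ} :
    syntacticCon L (gen n) (gen m) ↔ ∀ k, n + k ∈ L ↔ m + k ∈ L := by
  conv_rhs => rw [← length_gen n, ← length_gen m]
  rfl

/-- From `t + m` on, `n` and `n - m` are congruent, so every class has a representative below `t +
m`. -/
theorem finite_syntacticCon {L : Set ℕ} (h : EvPeriodic L) : Finite (syntacticCon L).Quotient := by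
  obtain ⟨t, m, hm, h⟩ := h
  refine Finite.of_surjective
    (fun i : Fin (t + m) => ((gen i : FreeMonoid Unit) : (syntacticCon L).Quotient)) fun q => ?_
  induction q using Con.induction_on with
  | H a =>
    rw [← gen_length a]
    generalize a.length = n
    induction n using Nat.strong_induction_on with
    | _ n ih =>
      rcases lt_or_ge n (t + m) with hn | hn
      · exact ⟨⟨n, hn⟩, rfl⟩
      · obtain ⟨i, hi⟩ := ih (n - m) (by omega)
        refine ⟨i, hi.trans ((Con.eq _).2 (syntacticCon_gen.2 fun k => ?_))⟩
        rw [← h _ (by omega), show n - m + k + m = n + k by omega]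

theorem EvPeriodic.exists_finCon {L : Set ℕ} (h : EvPeriodic L) :
    ∃ c : FinCon Unit, ∀ n m, cls c n = cls c m → (n ∈ L ↔ m ∈ L) :=
  ⟨⟨syntacticCon L, finite_syntacticCon h⟩, fun _ _ hnm =>
    syntacticCon_gen.1 ((Con.eq _).1 hnm) 0⟩

/-- Finite index congruences are directed downwards, since the quotient by an intersection embeds
into the product of the quotients. Hence one coordinate can always replace finitely many. -/
theorem exists_finCon_le (I : Finset (FinCon Unit)) : ∃ c : FinCon Unit, ∀ d ∈ I, c.1 ≤ d.1 := by
  classical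
  induction I using Finset.induction_on with
  | empty =>
    refine ⟨⟨⊤, ?_⟩, by simp⟩
    have : Subsingleton (⊤ : Con (FreeMonoid Unit)).Quotient := ⟨fun x y =>
      Con.induction_on₂ x y fun _ _ => (Con.eq _).2 trivial⟩
    infer_instance
  | insert a s _ ih =>
    obtain ⟨c, hc⟩ := ih
    have := a.2
    have := c.2
    refine ⟨⟨a.1 ⊓ c.1, Finite.of_injective (fun q : (a.1 ⊓ c.1).Quotient =>
      (Con.map _ a.1 inf_le_left q, Con.map _ c.1 inf_le_right q)) fun x y => ?_⟩,
      fun d hd => ?_⟩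
    · refine Con.induction_on₂ x y fun u v huv => (Con.eq _).2 ?_
      exact ⟨(Con.eq _).1 (congrArg Prod.fst huv), (Con.eq _).1 (congrArg Prod.snd huv)⟩
    · rcases Finset.mem_insert.1 hd with rfl | hd
      · exact inf_le_left
      · exact inf_le_right.trans (hc d hd)

theorem exists_finCon_le₂ (c d : FinCon Unit) : ∃ e : FinCon Unit, e.1 ≤ c.1 ∧ e.1 ≤ d.1 := by
  classical
  obtain ⟨e, he⟩ := exists_finCon_le {c, d}
  exact ⟨e, he c (by simp), he d (by simp)⟩

/-- The component of an element of the free profinite monoid at a congruence of finite index. -/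
def FreeProfiniteMonoid.coord (x : FreeProfiniteMonoid Unit) (c : FinCon Unit) : c.1.Quotient :=
  Subtype.val x c

open FreeProfiniteMonoid

variable {x y : FreeProfiniteMonoid Unit} {c d : FinCon Unit}

theorem FreeProfiniteMonoid.ext (h : ∀ c, x.coord c = y.coord c) : x = y :=
  Subtype.ext (funext h)

theorem coord_mul : (x * y).coord c = x.coord c * y.coord c := rfl

theorem map_coord (h : c.1 ≤ d.1) : Con.map c.1 d.1 h (x.coord c) = x.coord d := x.2 c d h

theorem map_cls (h : c.1 ≤ d.1) (n : ℕ) : Con.map c.1 d.1 h (cls c n) = cls d n := rfl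

/-- The canonical map from the natural numbers to the free profinite monoid. -/
def ofNat (n : ℕ) : FreeProfiniteMonoid Unit := ⟨fun c => cls c n, fun _ _ h => map_cls h n⟩

theorem ofNat_add (n m : ℕ) : ofNat (n + m) = ofNat n * ofNat m :=
  FreeProfiniteMonoid.ext fun c => cls_add c n m

/-- The natural numbers that agree with `x` modulo `c`. -/
def near (x : FreeProfiniteMonoid Unit) (c : FinCon Unit) : Set ℕ := {n | cls c n = x.coord c}

theorem near_nonempty (x : FreeProfiniteMonoid Unit) (c : FinCon Unit) : (near x c).Nonempty :=
  cls_surjective c _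

theorem near_mono (h : c.1 ≤ d.1) : near x c ⊆ near x d := fun n hn => by
  rw [near, Set.mem_ofPred_eq, ← map_coord h, ← map_cls h, hn]

theorem near_mul {n m : ℕ} (hn : n ∈ near x c) (hm : m ∈ near y c) : n + m ∈ near (x * y) c := by
  rw [near, Set.mem_ofPred_eq] at *
  rw [cls_add, hn, hm, coord_mul]

/-! ### Its topology -/

instance (c : FinCon Unit) : TopologicalSpace c.1.Quotient := ⊥

instance (c : FinCon Unit) : DiscreteTopology c.1.Quotient := ⟨rfl⟩

theorem continuous_coord (c : FinCon Unit) :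
    Continuous fun x : FreeProfiniteMonoid Unit => x.coord c :=
  (continuous_apply c).comp continuous_induced_dom

theorem isClopen_coord (c : FinCon Unit) (s : Set c.1.Quotient) :
    IsClopen {x : FreeProfiniteMonoid Unit | x.coord c ∈ s} :=
  (isClopen_discrete s).preimage (continuous_coord c)

theorem exists_coord_subset {U : Set (FreeProfiniteMonoid Unit)} (hU : IsOpen U) (hx : x ∈ U) :
    ∃ c : FinCon Unit, ∀ y : FreeProfiniteMonoid Unit, y.coord c = x.coord c → y ∈ U := by
  obtain ⟨V, hV, rfl⟩ := isOpen_induced_iff.1 hU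
  obtain ⟨I, u, hu, hI⟩ := isOpen_pi_iff.1 hV _ hx
  obtain ⟨c, hc⟩ := exists_finCon_le I
  refine ⟨c, fun y hy => hI fun d hd => ?_⟩
  have h1 : y.coord d = x.coord d := by rw [← map_coord (hc d hd), hy, map_coord]
  exact (h1 ▸ (hu d hd).2 : y.coord d ∈ u d)

instance : CompactSpace (FreeProfiniteMonoid Unit) := by
  have : ∀ c : FinCon Unit, Finite c.1.Quotient := fun c => c.2
  have h : IsClosed ((freeProfiniteMonoid Unit : Set (∀ c : FinCon Unit, c.1.Quotient))) := by
    have : (freeProfiniteMonoid Unit : Set (∀ c : FinCon Unit, c.1.Quotient)) =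
        ⋂ (c : FinCon Unit) (d : FinCon Unit) (h : c.1 ≤ d.1),
          {x | Con.map c.1 d.1 h (x c) = x d} := by
      ext x
      simp only [Set.mem_iInter]
      rfl
    rw [this]
    exact isClosed_iInter fun c => isClosed_iInter fun d => isClosed_iInter fun h =>
      isClosed_eq (continuous_of_discreteTopology.comp (continuous_apply c)) (continuous_apply d)
  exact isCompact_iff_compactSpace.1 h.isCompact

instance : T2Space (FreeProfiniteMonoid Unit) :=
  inferInstanceAs (T2Space {x : ∀ c : FinCon Unit, c.1.Quotient // x ∈ freeProfiniteMonoid Unit})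

instance : TotallyDisconnectedSpace (FreeProfiniteMonoid Unit) :=
  inferInstanceAs (TotallyDisconnectedSpace
    {x : ∀ c : FinCon Unit, c.1.Quotient // x ∈ freeProfiniteMonoid Unit})

instance : ContinuousMul (FreeProfiniteMonoid Unit) where
  continuous_mul := continuous_induced_rng.2 <| continuous_pi fun c =>
    (continuous_of_discreteTopology (f := fun q : c.1.Quotient × c.1.Quotient => q.1 * q.2)).comp
      (((continuous_coord c).comp continuous_fst).prodMk ((continuous_coord c).comp continuous_snd))

/-- Around each point membership in `A` is decided by one coordinate; `A` is compact, so finitely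
many coordinates suffice, and a common refinement replaces them. -/
theorem exists_finCon_of_isClopen {A : Set (FreeProfiniteMonoid Unit)} (hA : IsClopen A) :
    ∃ c : FinCon Unit, ∀ x y : FreeProfiniteMonoid Unit, x.coord c = y.coord c → x ∈ A → y ∈ A := by
  have : Nonempty (FinCon Unit) := (exists_finCon_le ∅).nonempty
  choose! c hc using fun x (hx : x ∈ A) => exists_coord_subset hA.isOpen hx
  obtain ⟨I, hI, hAI⟩ := hA.isClosed.isCompact.elim_finite_subcover_image
    (c := fun x => {y : FreeProfiniteMonoid Unit | y.coord (c x) = x.coord (c x)}) (b := A)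
    (fun x _ => (isClopen_coord (c x) {x.coord (c x)}).isOpen)
    (fun x hx => Set.mem_biUnion hx rfl)
  classical
  obtain ⟨e, he⟩ := exists_finCon_le (hAI.1.toFinset.image c)
  refine ⟨e, fun x y hxy hx => ?_⟩
  obtain ⟨z, hz, hxz⟩ := Set.mem_iUnion₂.1 (hAI.2 hx)
  refine hc z (hI hz) y (Eq.trans ?_ hxz)
  have h1 := he (c z) (Finset.mem_image_of_mem c (hAI.1.mem_toFinset.2 hz))
  rw [← map_coord h1, ← hxy, map_coord]

theorem evPeriodic_preimage {A : Set (FreeProfiniteMonoid Unit)} (hA : IsClopen A) :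
    EvPeriodic (ofNat ⁻¹' A) := by
  obtain ⟨c, hc⟩ := exists_finCon_of_isClopen hA
  exact evPeriodic_of_finCon c fun n m h => ⟨hc _ _ h, hc _ _ h.symm⟩

/-- The sums of natural numbers in `A` and in `B` form an eventually periodic set, a union of
classes of some `c`. The product of `A` and `B` is the clopen set of all points lying in these
classes. -/
theorem isClopen_mul_freeProfiniteMonoid {A B : Set (FreeProfiniteMonoid Unit)} (hA : IsClopen A)
    (hB : IsClopen B) : IsClopen {z | ∃ x ∈ A, ∃ y ∈ B, x * y = z} := by
  obtain ⟨c, hc⟩ :=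
    ((evPeriodic_preimage hA).add (evPeriodic_preimage hB)).exists_finCon
  have hcl : IsClosed {z | ∃ x ∈ A, ∃ y ∈ B, x * y = z} :=
    (hA.isClosed.isCompact.mul hB.isClosed.isCompact).isClosed
  suffices h : {z | ∃ x ∈ A, ∃ y ∈ B, x * y = z} = {z | z.coord c ∈
      {q | ∃ i j, ofNat i ∈ A ∧ ofNat j ∈ B ∧ cls c (i + j) = q}} by
    rw [h]
    exact isClopen_coord c _
  refine Set.Subset.antisymm ?_ fun z hz => ?_
  -- Replace `x` and `y` by natural numbers so close that they stay in `A` and `B` and have the same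
  -- `c`-classes.
  · rintro _ ⟨x, hx, y, hy, rfl⟩
    obtain ⟨a, ha⟩ := exists_finCon_of_isClopen hA
    obtain ⟨b, hb⟩ := exists_finCon_of_isClopen hB
    obtain ⟨d, hda, hdb⟩ := exists_finCon_le₂ a b
    obtain ⟨e, hed, hec⟩ := exists_finCon_le₂ d c
    obtain ⟨i, hi⟩ := near_nonempty x e
    obtain ⟨j, hj⟩ := near_nonempty y e
    exact ⟨i, j, ha x _ (near_mono (hed.trans hda) hi).symm hx,
      hb y _ (near_mono (hed.trans hdb) hj).symm hy, near_mul (near_mono hec hi) (near_mono hec hj)⟩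
  -- The product of compact sets is closed, so it is enough to find sums of natural numbers
  -- arbitrarily near `z`.
  · rw [← hcl.closure_eq, mem_closure_iff]
    intro U hU hzU
    obtain ⟨d, hd⟩ := exists_coord_subset hU hzU
    obtain ⟨e, hed, hec⟩ := exists_finCon_le₂ d c
    obtain ⟨n, hn⟩ := near_nonempty z e
    obtain ⟨i, j, hi, hj, hij⟩ := hz
    obtain ⟨i', hi', j', hj', h⟩ := (hc _ _ (hij.trans (near_mono hec hn).symm)).1
      ⟨i, hi, j, hj, rfl⟩
    refine ⟨ofNat n, hd _ (near_mono hed hn), ofNat i', hi', ofNat j', hj', ?_⟩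
    rw [← ofNat_add, h]

theorem isBooleanTernarySpace_freeProfiniteMonoid :
    IsBooleanTernarySpace (graph fun a b : FreeProfiniteMonoid Unit => a * b) where
  compact := inferInstance
  hausdorff := inferInstance
  totallyDisconnected := inferInstance
  isClopen_mul _ _ hA hB := isClopen_mul_freeProfiniteMonoid hA hB
  isClosed_fibre _ := isClosed_eq continuous_mul continuous_const

end FreeProfinite

/-! ### The isomorphism -/

section Isomorphism

/-- A spectrum is a union of classes of some `c`, so the single class `near x c` lies inside it or
inside its complement. This is completeness of `limitTheory x`. -/
theorem spec_or_compl_mem (φ : lang.Sentence) (x : FreeProfiniteMonoid Unit) :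
    (∃ c, near x c ⊆ spec φ) ∨ ∃ c, near x c ⊆ spec (∼φ) := by
  obtain ⟨c, hc⟩ := (evPeriodic_spec φ).exists_finCon
  obtain ⟨n, hn⟩ := near_nonempty x c
  by_cases h : n ∈ spec φ
  · exact Or.inl ⟨c, fun m hm => (hc n m (hn.trans hm.symm)).1 h⟩
  · exact Or.inr ⟨c, fun m hm hm' => h ((hc n m (hn.trans hm.symm)).2 hm')⟩

theorem exists_near_of_finset (x : FreeProfiniteMonoid Unit) (s : Finset lang.Sentence)
    (h : ∀ φ ∈ s, ∃ c, near x c ⊆ spec φ) : ∃ n, ∀ φ ∈ s, n ∈ spec φ := by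
  classical
  have : Nonempty (FinCon Unit) := (exists_finCon_le ∅).nonempty
  choose! c hc using h
  obtain ⟨e, he⟩ := exists_finCon_le (s.image c)
  obtain ⟨n, hn⟩ := near_nonempty x e
  exact ⟨n, fun φ hφ => hc φ hφ (near_mono (he _ (Finset.mem_image_of_mem c hφ)) hn)⟩

/-- The theory of a profinite number. -/
def limitTheory (x : FreeProfiniteMonoid Unit) : ZeroTypes TMSOFin :=
  ⟨{φ | ∃ c, near x c ⊆ spec φ}, by
    refine ⟨fun φ hφ => ?_, ?_, fun φ => spec_or_compl_mem φ x⟩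
    · obtain ⟨c, -⟩ := exists_finCon_le ∅
      exact ⟨c, fun n _ => (good_powS n).model.realize_of_mem φ hφ⟩
    -- By the compactness theorem it suffices that finitely many of the sentences hold in one `PowS
    -- n`, with `n` near `x` modulo a common refinement.
    · rw [Theory.isSatisfiable_iff_isFinitelySatisfiable]
      intro s hs
      obtain ⟨n, hn⟩ := exists_near_of_finset x s fun φ hφ => hs hφ
      have : PowS n ⊨ (s : lang.Theory) := (Theory.model_iff _).2 fun φ hφ => hn φ hφ
      have : Nonempty (PowS n) := ⟨⟨∅⟩⟩
      exact Theory.Model.isSatisfiable (PowS n)⟩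

theorem continuous_limitTheory : Continuous limitTheory := by
  refine continuous_generateFrom_iff.2 ?_
  rintro _ ⟨φ, rfl⟩
  have : limitTheory ⁻¹' {p | φ ∈ p.1} =
      ⋃ c : FinCon Unit, {x | x.coord c ∈ {q | {n | cls c n = q} ⊆ spec φ}} := by
    ext x
    rw [Set.mem_iUnion]
    rfl
  rw [this]
  exact isOpen_iUnion fun c => (isClopen_coord c _).isOpen

/-- One inclusion is enough. If it failed at `φ`, natural numbers `n` near `x` and `m` near `y`
would give a size `n + m` at which both `φ` and its negation hold. -/
theorem limitTheory_mul (x y : FreeProfiniteMonoid Unit) :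
    limitTheory (x * y) = concatTheory (limitTheory x) (limitTheory y) := by
  refine (ZeroTypes.ext ?_).symm
  rintro φ ⟨r, hr, ⟨c, hc⟩, ⟨d, hd⟩⟩
  refine (spec_or_compl_mem φ (x * y)).resolve_right ?_
  rintro ⟨e, he⟩
  obtain ⟨a, hac, had⟩ := exists_finCon_le₂ c d
  obtain ⟨b, hba, hbe⟩ := exists_finCon_le₂ a e
  obtain ⟨n, hn⟩ := near_nonempty x b
  obtain ⟨m, hm⟩ := near_nonempty y b
  exact he (near_mul (near_mono hbe hn) (near_mono hbe hm)) (mem_spec_add.2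
    ⟨r, hr, hc (near_mono (hba.trans hac) hn), hd (near_mono (hba.trans had) hm)⟩)

/-- Each class of a finite index congruence is a spectrum, so the theory of `x` determines every
coordinate of `x`. -/
theorem limitTheory_injective : Function.Injective limitTheory := by
  intro x y hxy
  refine FreeProfiniteMonoid.ext fun c => ?_
  obtain ⟨φ, hφ⟩ := (evPeriodic_cls c (x.coord c)).exists_spec_eq
  have h1 : φ ∈ (limitTheory x).1 := ⟨c, hφ.ge⟩
  rw [hxy] at h1
  obtain ⟨d, hd⟩ := h1
  obtain ⟨e, hec, hed⟩ := exists_finCon_le₂ c d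
  obtain ⟨n, hn⟩ := near_nonempty y e
  have h2 : n ∈ spec φ := hd (near_mono hed hn)
  rw [hφ] at h2
  exact h2.symm.trans (near_mono hec hn)

/-- A model `M` of `p` picks for each `c` a class `q c` whose defining sentence it satisfies.
Pseudofiniteness transfers to `M` what holds in all finite models: some class occurs, the classes
for different `c` are compatible, and they decide every sentence. -/
theorem limitTheory_surjective : Function.Surjective limitTheory := by
  intro p
  obtain ⟨M⟩ := p.2.2.1
  have hM : Good M := p.good M.is_model
  choose f hf using fun (c : FinCon Unit) (q : c.1.Quotient) => (evPeriodic_cls c q).exists_spec_eq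
  have h1 : ∀ c, ∃ q, M ⊨ f c q := fun c => by
    by_contra h
    push Not at h
    have := c.2
    have := Fintype.ofFinite c.1.Quotient
    -- `σ` says that the size lies in no class of `c`, which is false in every `PowS n`.
    let σ : lang.Sentence := ((Finset.univ : Finset c.1.Quotient).toList.map
      fun q => ∼(f c q)).foldr (· ⊓ ·) ⊤
    have hσ : ∀ (K : Type) [lang.Structure K], K ⊨ σ ↔ ∀ q, ¬ K ⊨ f c q := fun K _ => by
      refine (BoundedFormula.realize_foldr_inf _ _ _).trans ?_
      simp only [List.mem_map, Finset.mem_toList, Finset.mem_univ, true_and,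
        forall_exists_index, forall_apply_eq_imp_iff]
      exact Iff.rfl
    obtain ⟨n, hn⟩ := hM.exists_powS ((hσ M).2 h)
    have hn' : n ∈ spec (f c (cls c n)) := by rw [hf]; rfl
    exact (hσ (PowS n)).1 hn _ hn'
  choose q hq using h1
  -- A finite model satisfying both defining sentences has a size `n` representing both classes.
  have h2 : ∀ (c d : FinCon Unit) (h : c.1 ≤ d.1), Con.map c.1 d.1 h (q c) = q d := fun c d h => by
    obtain ⟨n, hn⟩ := hM.exists_powS ((Sentence.realize_inf M).2 ⟨hq c, hq d⟩)
    have hn' : n ∈ spec (f c (q c) ⊓ f d (q d)) := hn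
    rw [spec_inf, hf, hf] at hn'
    rw [← hn'.1, ← hn'.2, map_cls]
  refine ⟨⟨q, h2⟩, (ZeroTypes.ext fun φ hφ => ?_).symm⟩
  refine (spec_or_compl_mem φ _).resolve_right ?_
  rintro ⟨c, hc⟩
  obtain ⟨n, hn⟩ := hM.exists_powS
    ((Sentence.realize_inf M).2 ⟨hq c, (mem_iff_realize p.2.2 M.is_model φ).1 hφ⟩)
  have hn' : n ∈ spec (f c (q c) ⊓ φ) := hn
  rw [spec_inf, hf] at hn'
  exact hc hn'.1 hn'.2

/-- The homeomorphism between the free profinite monoid on one generator and the space of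
completions. -/
noncomputable def limitHomeomorph : FreeProfiniteMonoid Unit ≃ₜ ZeroTypes TMSOFin :=
  continuous_limitTheory.homeoOfEquivCompactToT2
    (f := Equiv.ofBijective limitTheory ⟨limitTheory_injective, limitTheory_surjective⟩)

theorem limitHomeomorph_mul (x y : FreeProfiniteMonoid Unit) :
    limitHomeomorph (x * y) = concatTheory (limitHomeomorph x) (limitHomeomorph y) :=
  limitTheory_mul x y

-- Transport of compatible operations along a homeomorphism.

section Transport

variable {X : Type u₁} {Y : Type u₂} [TopologicalSpace X] [TopologicalSpace Y] {f : X → X → X}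
  {g : Y → Y → Y} (e : X ≃ₜ Y) (he : ∀ x y, e (f x y) = g (e x) (e y))

include he

theorem isBooleanTernarySpace_of_homeomorph (h : IsBooleanTernarySpace (graph f)) :
    IsBooleanTernarySpace (graph g) where
  compact := have := h.compact; e.compactSpace
  hausdorff := have := h.hausdorff; e.t2Space
  totallyDisconnected := have := h.totallyDisconnected; e.totallyDisconnectedSpace
  isClopen_mul A B hA hB := by
    have h1 := (h.isClopen_mul _ _ (hA.preimage e.continuous) (hB.preimage e.continuous)).preimage
      e.symm.continuous
    convert h1 using 1
    ext z
    constructor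
    · rintro ⟨x, hx, y, hy, rfl⟩
      refine ⟨e.symm x, by simpa using hx, e.symm y, by simpa using hy, ?_⟩
      rw [graph, Homeomorph.eq_symm_apply, he]
      simp
    · rintro ⟨x, hx, y, hy, h2⟩
      refine ⟨e x, hx, e y, hy, ?_⟩
      rw [graph, ← he, h2]
      simp
  isClosed_fibre z := by
    have h1 := (h.isClosed_fibre (e.symm z)).preimage
      (e.symm.continuous.prodMap e.symm.continuous)
    convert h1 using 1
    ext p
    change g p.1 p.2 = z ↔ f (e.symm p.1) (e.symm p.2) = e.symm z
    rw [Homeomorph.eq_symm_apply, he]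
    simp

/-- For graphs of operations the lifting condition follows from bijectivity: the preimages of the
two factors multiply to the given point. -/
theorem isBoundedMorphism_of_homeomorph : IsBoundedMorphism (graph f) (graph g) e where
  continuous := e.continuous
  map x y z h := by rw [graph, ← he, h]
  lift z x' y' h := by
    refine ⟨e.symm x', e.symm y', by simp, by simp, e.injective ?_⟩
    rw [he, ← h]
    simp

theorem symm_map_mul (x y : Y) : e.symm (g x y) = f (e.symm x) (e.symm y) := by
  rw [Homeomorph.symm_apply_eq, he]
  simp

theorem isomorphic_of_homeomorph : Isomorphic (graph g) (graph f) :=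
  ⟨e.symm, e, isBoundedMorphism_of_homeomorph e.symm (symm_map_mul e he),
    isBoundedMorphism_of_homeomorph e he, e.apply_symm_apply, e.symm_apply_apply⟩

end Transport

end Isomorphism

end MSOFin

theorem mainTheorem3 :
    ∃ op : MSOFin.ZeroTypes MSOFin.TMSOFin → MSOFin.ZeroTypes MSOFin.TMSOFin →
        MSOFin.ZeroTypes MSOFin.TMSOFin,
      (∀ (x y : MSOFin.ZeroTypes MSOFin.TMSOFin)
        (M : Type*) [MSOFin.lang.Structure M] (N : Type*) [MSOFin.lang.Structure N],
        M ⊨ x.1 → N ⊨ y.1 →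
          MSOFin.lang.completeTheory (MSOFin.Concat M N) = (op x y).1) ∧
      MSOFin.IsBooleanTernarySpace (MSOFin.graph op) ∧
      MSOFin.IsBooleanTernarySpace
        (MSOFin.graph fun a b : MSOFin.FreeProfiniteMonoid Unit => a * b) ∧
      MSOFin.Isomorphic (MSOFin.graph op)
        (MSOFin.graph fun a b : MSOFin.FreeProfiniteMonoid Unit => a * b) :=
  ⟨MSOFin.concatTheory, fun x y _ _ _ _ => MSOFin.completeTheory_concat x y,
    MSOFin.isBooleanTernarySpace_of_homeomorph MSOFin.limitHomeomorph MSOFin.limitHomeomorph_mul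
      MSOFin.isBooleanTernarySpace_freeProfiniteMonoid,
    MSOFin.isBooleanTernarySpace_freeProfiniteMonoid,
    MSOFin.isomorphic_of_homeomorph MSOFin.limitHomeomorph MSOFin.limitHomeomorph_mul⟩
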